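/- Let $d:\mathcal T\times\mathcal T\to[0,1]$ be a premetric ($d(t,t')=d(t',t)$, $d(t,t)=0$) on a set $\mathcal T$ such that $(d,\mathcal T)$ is infinitely separable: there is a countable $\mathfrak T\subseteq\mathcal T$ such that every $t\in\mathcal T$ is the limit ($d(t_n,t)\to0$) of a $d$-Cauchy sequence $(t_n)$ in $\mathfrak T$ taking infinitely many distinct values. Let $X=(X_t)_{t\in\mathcal T}$ be a stochastic process on a probability space $(\Omega,P)$ with values in a standard Borel space $\mathcal X$ which is locally exchangeable with respect to $d$: for every finite $T\subset\mathcal T$ and every injection $\pi:T\to\mathcal T$, the total variation distance $\sup_A|\Pr((X_t)_{t\in T}\in A)-\Pr((X_{\pi(t)})_{t\in T}\in A)|$ is at most $\sum_{t\in T}d(t,\pi(t))$. Let $\mathcal T$ be partitioned into disjoint bins $\{\mathcal T_k\}_{k\ge1}$ (possibly empty), and let $T=\{\tau_1,\dots,\tau_N\}$ be a random set of $N$ distinct covariates, where $\tau_i$ lies in a known bin $\mathcal T_{b(i)}$. Thus $T_k=T\cap\mathcal T_k=\{\tau_i:b(i)=k\}$ has a known number of points but random positions. The tuple $(\tau_1,\dots,\tau_N)$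 may have any joint law (for instance, independent $T_k\sim\mu_k$, or deterministic positions), and is independent of $X$ and $G$; precisely, the $\tau_i$ live on a second probability space $(\Xi,Q)$ and everything is considered on $(\Omega\times\Xi,P\otimes Q)$, where $X_T=(X_{\tau_1},\dots,X_{\tau_N})$ and the $d(\tau_i,\tau_j)$ are assumed measurable. Let $\widehat G=(\widehat G_k)_k$ with $\widehat G_k=\sum_{t\in T_k}\delta_{X_t}$ be the binned empirical measures, let $\mathcal G$ be the group of permutations $\pi$ of $T$ with $\pi(T_k)=T_k$ for all $k$, and let $\pi$ be uniformly distributed on $\mathcal G$ given $T$. Theorem. There is a process $G=(G_t)_{t\in\mathcal T}$ of random probability measures on $\mathcal X$, defined on $\Omega$, such that for all finite $S\subset\mathcal T$ and all $t,t'\in\mathcal T$, $$\Pr(X_S\in\cdot\mid G)=\prod_{s\in S}G_s\ \text{ a.s.},\qquad \sup_A\mathbb E|G_t(A)-G_{t'}(A)|\le d(t,t').\qquad(*)$$ Moreover, for every such $G$ and every bounded measurable $h:\mathcal X^N\to\mathbb R$, with $\|h\|_\infty=\sup_x|h(x)|$, $$\mathbb E\left|\mathbb E[h(X_T)\mid\widehat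 G,G]-\mathbb E[h(X_T)\mid\widehat G]\right|\le 4\|h\|_\infty\,\mathbb E\left[\sum_{t\in T}d(t,\pi(t))\right],$$ where the expectation on the right is over both $T$ and $\pi$. -/

import Mathlib

open MeasureTheory ProbabilityTheory Filter Topology

noncomputable section

namespace LocalExch

/-- A premetric `d : 𝒯 × 𝒯 → [0,1]`: symmetric and vanishing on the diagonal. -/
structure IsPremetric {𝒯 : Type*} (d : 𝒯 → 𝒯 → ℝ) : Prop where
  nonneg : ∀ s t, 0 ≤ d s t
  le_one : ∀ s t, d s t ≤ 1
  symm : ∀ s t, d s t = d t s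
  self_eq_zero : ∀ t, d t t = 0

/-- `(d, 𝒯)` is infinitely separable: there is a countable `S ⊆ 𝒯` such that every `t` is the
limit of a `d`-Cauchy sequence in `S` which takes infinitely many values. -/
def InfinitelySeparable {𝒯 : Type*} (d : 𝒯 → 𝒯 → ℝ) : Prop :=
  ∃ S : Set 𝒯, S.Countable ∧ ∀ t : 𝒯, ∃ u : ℕ → 𝒯,
    (∀ n, u n ∈ S) ∧
    (∀ ε > 0, ∃ N, ∀ m ≥ N, ∀ n ≥ N, d (u m) (u n) < ε) ∧
    Tendsto (fun n => d (u n) t) atTop (𝓝 0) ∧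
    (Set.range u).Infinite

/-- Total variation distance `sup_A |μ(A) - ν(A)|` over measurable sets `A`
(used for probability measures only). -/
def tvDist {α : Type*} [MeasurableSpace α] (μ ν : Measure α) : ℝ :=
  ⨆ A : {A : Set α // MeasurableSet A}, |μ.real A - ν.real A|

/-- `X` is locally exchangeable with respect to `d`: for every finite `T ⊆ 𝒯` and every
injection `π : T → 𝒯`, the laws of `(X_t)_{t ∈ T}` and `(X_{π(t)})_{t ∈ T}` are within
`∑_{t ∈ T} d(t, π(t))` in total variation. -/
def LocallyExchangeable {𝒯 Ω 𝒳 : Type*} [MeasurableSpace Ω] [MeasurableSpace 𝒳]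
    (P : Measure Ω) (d : 𝒯 → 𝒯 → ℝ) (X : 𝒯 → Ω → 𝒳) : Prop :=
  ∀ (T : Finset 𝒯) (π : T → 𝒯), Function.Injective π →
    tvDist (P.map fun ω (t : T) => X t ω) (P.map fun ω (t : T) => X (π t) ω)
      ≤ ∑ t : T, d t (π t)

/-- The σ-algebra generated by a random-measure-valued process `G = (G_t)_{t ∈ 𝒯}`. -/
abbrev processSigma {𝒯 Ω 𝒳 : Type*} [MeasurableSpace Ω] [MeasurableSpace 𝒳]
    (G : 𝒯 → Kernel Ω 𝒳) : MeasurableSpace Ω :=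
  ⨆ t, MeasurableSpace.comap (fun ω => G t ω) inferInstance

/-- `G = (G_t)_{t ∈ 𝒯}` is a mixing (de Finetti) process of `X`: a process of random probability
measures such that, given `G`, the observations `X_T` have law `∏_{t ∈ T} G_t` for every finite
`T`, and `sup_A E|G_t(A) - G_{t'}(A)| ≤ d(t, t')`. -/
structure IsMixingProcess {𝒯 Ω 𝒳 : Type*} [MeasurableSpace Ω] [MeasurableSpace 𝒳]
    (P : Measure Ω) (d : 𝒯 → 𝒯 → ℝ) (X : 𝒯 → Ω → 𝒳) (G : 𝒯 → Kernel Ω 𝒳) : Prop where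
  markov : ∀ t, IsMarkovKernel (G t)
  condLaw : ∀ (T : Finset 𝒯) (B : Set (T → 𝒳)), MeasurableSet B →
    P[((fun ω (t : T) => X t ω) ⁻¹' B).indicator (fun _ => (1 : ℝ)) | processSigma G]
      =ᵐ[P] fun ω => (Measure.pi fun t : T => G t ω).real B
  smooth : ∀ (t t' : 𝒯) (A : Set 𝒳), MeasurableSet A →
    ∫ ω, |(G t ω).real A - (G t' ω).real A| ∂P ≤ d t t'

/-- The binned empirical measures `Ĝ_k = ∑_{i : b(i) = k} δ_{x_i}`, `k ∈ ℕ`, of a list of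
observations `x_1, …, x_N`, where `b(i)` is the bin of the `i`-th observation. -/
def binnedEmpirical {𝒳 : Type*} [MeasurableSpace 𝒳] {N : ℕ} (b : Fin N → ℕ)
    (x : Fin N → 𝒳) : ℕ → Measure 𝒳 :=
  fun k => ∑ i with b i = k, Measure.dirac (x i)

/-- The permutations of the observations that permute only within bins. -/
def binPerms {N : ℕ} (b : Fin N → ℕ) : Finset (Equiv.Perm (Fin N)) :=
  {σ | ∀ i, b (σ i) = b i}

/-- `E[∑_{t ∈ T} d(t, π(t))]`, with `π` uniform on the within-bin permutations of the random
covariates `T = {τ_1, …, τ_N}` and the expectation taken over `π` and over `T`. -/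
def expectedSwapCost {𝒯 Ξ : Type*} [MeasurableSpace Ξ] (Q : Measure Ξ) (d : 𝒯 → 𝒯 → ℝ)
    {N : ℕ} (b : Fin N → ℕ) (τ : Fin N → Ξ → 𝒯) : ℝ :=
  ∫ ξ, ((binPerms b).card : ℝ)⁻¹ * ∑ σ ∈ binPerms b, ∑ i, d (τ i ξ) (τ (σ i) ξ) ∂Q

/-- The observations `X_T` at the random covariates `T = {τ_1, …, τ_N}`, on the product of the
probability space of `X` and that of `T` (so that `T` is independent of `X` and `G`). -/
def obs {𝒯 Ω 𝒳 Ξ : Type*} (X : 𝒯 → Ω → 𝒳) {N : ℕ} (τ : Fin N → Ξ → 𝒯) :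
    Ω × Ξ → Fin N → 𝒳 :=
  fun p i => X (τ i p.2) p.1

/-- `σ(Ĝ)`, on the product space. -/
abbrev empiricalSigma {𝒯 Ω 𝒳 Ξ : Type*} [MeasurableSpace 𝒳] (X : 𝒯 → Ω → 𝒳) {N : ℕ}
    (b : Fin N → ℕ) (τ : Fin N → Ξ → 𝒯) : MeasurableSpace (Ω × Ξ) :=
  MeasurableSpace.comap (fun p => binnedEmpirical b (obs X τ p)) inferInstance

/-- `σ(Ĝ, G)`, on the product space. -/
abbrev empiricalMixingSigma {𝒯 Ω 𝒳 Ξ : Type*} [MeasurableSpace Ω] [MeasurableSpace 𝒳]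
    (X : 𝒯 → Ω → 𝒳) (G : 𝒯 → Kernel Ω 𝒳) {N : ℕ}
    (b : Fin N → ℕ) (τ : Fin N → Ξ → 𝒯) : MeasurableSpace (Ω × Ξ) :=
  empiricalSigma X b τ ⊔ MeasurableSpace.comap Prod.fst (processSigma G)

end LocalExch

end

/-! ### Local exchangeability for infinite families and bounded functions -/

noncomputable section

namespace LocalExch

/-! The bound rests on a swap. Let c be the average of h(X_T) over the within-bin permutations. It
is symmetric within bins, hence a function of Ĝ (`measurable_comap_binnedEmpirical`), so it cancels
from the difference of the two conditional expectations. The tower property then bounds the L¹ norm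
of that difference by 2 E|E[h(X_T) - c | Ĝ, G]| (`integral_abs_condExp_sub_condExp_le`). Testing
against a sign g, a function of (Ĝ, G) with |g| ≤ 1, leaves an average over σ of E[(h(X_T) -
h(X_σT)) g]. Since Ĝ does not see σ, local exchangeability bounds each term by 2‖h‖ ∑ d(t, σt),
provided that G does not see the observations on T either
(`IsMixingProcess.abs_integral_sub_perm_le`). The two factors 2 give the constant 4.

The heart of the proof is therefore a tail property: G_t(A) is a.s. a function of the observations
outside any given finite set. It is an L² limit of averages of the indicators of X_{u_n} ∈ A along
distinct covariates u_n → t, and finitely many u_n may be dropped. The averages converge because the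
deviations of the indicators from G_t(A) are asymptotically uncorrelated
(`aestronglyMeasurable_of_forall_integral_mul_le`). For an arbitrary mixing process, conditional
independence and smoothness control the correlations (`IsMixingProcess.aestronglyMeasurable_real`).

For existence, G_t is the conditional law of X_t given all other observations. Moving u_n to t by
local exchangeability controls the same correlations
(`LocallyExchangeable.aestronglyMeasurable_directingKernel`), so the tail property holds before
conditional independence is known. It lets the factors of a product event be replaced by their
conditional probabilities one at a time (`integral_prod_hit_mul`), and it makes the sign of G_t(A) -
G_{t'}(A) an admissible weight when t is moved to t', which yields smoothness. -/

theorem abs_real_sub_le_tvDist {α : Type*} [MeasurableSpace α] (μ ν : Measure α)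
    [IsProbabilityMeasure μ] [IsProbabilityMeasure ν] {A : Set α} (hA : MeasurableSet A) :
    |μ.real A - ν.real A| ≤ tvDist μ ν := by
  refine le_ciSup (f := fun A : {A : Set α // MeasurableSet A} => |μ.real A - ν.real A|)
    ⟨1, ?_⟩ ⟨A, hA⟩
  rintro _ ⟨B, rfl⟩
  have h1 : μ.real B ≤ 1 := measureReal_le_one
  have h2 : ν.real B ≤ 1 := measureReal_le_one
  have h3 : 0 ≤ μ.real B := measureReal_nonneg
  have h4 : 0 ≤ ν.real B := measureReal_nonneg
  exact abs_le.2 ⟨by linarith, by linarith⟩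

/-- A uniform bound for the difference of two probability measures on measurable sets extends to
bounded measurable functions. -/
theorem abs_integral_sub_le_of_abs_real_sub_le {α : Type*} [MeasurableSpace α] {μ ν : Measure α}
    [IsProbabilityMeasure μ] [IsProbabilityMeasure ν] {c : ℝ}
    (h : ∀ D, MeasurableSet D → |μ.real D - ν.real D| ≤ c) {H : α → ℝ} (hH : Measurable H)
    {a b : ℝ} (hab : a ≤ b) (ha : ∀ x, a ≤ H x) (hb : ∀ x, H x ≤ b) :
    |∫ x, H x ∂μ - ∫ x, H x ∂ν| ≤ (b - a) * c := by
  have hint : ∀ (ρ : Measure α) [IsProbabilityMeasure ρ], Integrable H ρ := fun ρ _ =>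
    Integrable.of_bound hH.aestronglyMeasurable (max |a| |b|)
      (ae_of_all _ fun x => abs_le_max_abs_abs (ha x) (hb x))
  -- Layer-cake formula for H - a, whose levels fill an interval of length b - a. The final constant
  -- is thus the oscillation of H rather than twice its supremum.
  have key : ∀ (ρ : Measure α) [IsProbabilityMeasure ρ], ∫ x, H x ∂ρ =
      a + ∫ t in Set.Ioc 0 (b - a), ρ.real {x | t ≤ H x - a} := by
    intro ρ _
    have h1 := ((hint ρ).sub (integrable_const a)).integral_eq_integral_Ioc_meas_le
      (M := b - a) (ae_of_all _ fun x => sub_nonneg.2 (ha x))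
      (ae_of_all _ fun x => sub_le_sub_right (hb x) a)
    simp only [Pi.sub_apply] at h1
    rw [← h1, integral_sub (hint ρ) (integrable_const a)]
    simp
  have hm : ∀ (ρ : Measure α) [IsProbabilityMeasure ρ],
      IntegrableOn (fun t => ρ.real {x | t ≤ H x - a}) (Set.Ioc 0 (b - a)) := by
    intro ρ _
    have hanti : Antitone fun t => ρ.real {x | t ≤ H x - a} := fun s t hst =>
      measureReal_mono fun x (hx : t ≤ H x - a) => hst.trans hx
    exact Integrable.of_bound hanti.measurable.aestronglyMeasurable 1 (ae_of_all _ fun t => by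
      rw [Real.norm_of_nonneg measureReal_nonneg]; exact measureReal_le_one)
  rw [key μ, key ν, add_sub_add_left_eq_sub, ← integral_sub (hm μ) (hm ν), ← Real.norm_eq_abs]
  refine (norm_setIntegral_le_of_norm_le_const (C := c) (by simp) fun t _ => ?_).trans ?_
  · exact h _ (measurableSet_le measurable_const (hH.sub_const a))
  · simp [hab, mul_comm]

/-- The observations at the covariates outside `R`. -/
def rest {𝒯 Ω 𝒳 : Type*} (X : 𝒯 → Ω → 𝒳) (R : Set 𝒯) : Ω → ({r // r ∉ R} → 𝒳) :=
  fun ω r => X r ω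

/-- The σ-algebra generated by the observations at the covariates outside `R`. -/
abbrev restSigma {𝒯 Ω 𝒳 : Type*} [MeasurableSpace 𝒳] (X : 𝒯 → Ω → 𝒳) (R : Set 𝒯) :
    MeasurableSpace Ω :=
  MeasurableSpace.comap (rest X R) inferInstance

theorem measurable_restSigma {𝒯 Ω 𝒳 : Type*} [MeasurableSpace 𝒳] {X : 𝒯 → Ω → 𝒳} {t : 𝒯}
    {R : Set 𝒯} (ht : t ∉ R) : Measurable[restSigma X R] (X t) :=
  (measurable_pi_apply (⟨t, ht⟩ : {r // r ∉ R})).comp (comap_measurable (rest X R))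

theorem restSigma_anti {𝒯 Ω 𝒳 : Type*} [MeasurableSpace 𝒳] {X : 𝒯 → Ω → 𝒳} {R R' : Set 𝒯}
    (h : R ⊆ R') : restSigma X R' ≤ restSigma X R := by
  have : @Measurable _ _ (restSigma X R) _ (rest X R') :=
    @measurable_pi_lambda _ _ _ (restSigma X R) _ _ fun r =>
      measurable_restSigma fun hr => r.2 (h hr)
  exact this.comap_le

variable {𝒯 Ω 𝒳 : Type*} [MeasurableSpace Ω] [MeasurableSpace 𝒳]
  {P : Measure Ω} [IsProbabilityMeasure P] {d : 𝒯 → 𝒯 → ℝ} {X : 𝒯 → Ω → 𝒳}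

theorem measurable_rest (hX : ∀ t, Measurable (X t)) (R : Set 𝒯) : Measurable (rest X R) :=
  measurable_pi_lambda _ fun _ => hX _

theorem restSigma_le (hX : ∀ t, Measurable (X t)) (R : Set 𝒯) :
    restSigma X R ≤ ‹MeasurableSpace Ω› := (measurable_rest hX R).comap_le

/-- Local exchangeability for two injective finite families of covariates. -/
theorem LocallyExchangeable.abs_real_sub_le (hexch : LocallyExchangeable P d X)
    (hX : ∀ t, Measurable (X t)) {κ : Type*} [Fintype κ] {s s' : κ → 𝒯}
    (hs : Function.Injective s) (hs' : Function.Injective s') {D : Set (κ → 𝒳)}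
    (hD : MeasurableSet D) :
    |P.real ((fun ω k => X (s k) ω) ⁻¹' D) - P.real ((fun ω k => X (s' k) ω) ⁻¹' D)|
      ≤ ∑ k, d (s k) (s' k) := by
  classical
  let T : Finset 𝒯 := Finset.univ.map ⟨s, hs⟩
  have hT : ∀ k, s k ∈ T := fun k => by simp [T]
  let e : κ ≃ T := Equiv.ofBijective (fun k => ⟨s k, hT k⟩)
    ⟨fun a b hab => hs (congrArg Subtype.val hab), fun ⟨t, ht⟩ => by
      obtain ⟨k, -, rfl⟩ := Finset.mem_map.1 ht
      exact ⟨k, rfl⟩⟩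
  have he : ∀ k, ((e k : T) : 𝒯) = s k := fun k => rfl
  have h := hexch T (s' ∘ e.symm) (hs'.comp e.symm.injective)
  have hm1 : Measurable fun ω (t : T) => X t ω := measurable_pi_lambda _ fun t => hX t
  have hm2 : Measurable fun ω (t : T) => X ((s' ∘ e.symm) t) ω :=
    measurable_pi_lambda _ fun t => hX _
  have hD' : MeasurableSet ((fun (x : T → 𝒳) k => x (e k)) ⁻¹' D) :=
    (measurable_pi_lambda _ fun k => measurable_pi_apply (e k)) hD
  have := Measure.isProbabilityMeasure_map (μ := P) hm1.aemeasurable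
  have := Measure.isProbabilityMeasure_map (μ := P) hm2.aemeasurable
  have h2 := (abs_real_sub_le_tvDist _ _ hD').trans h
  rw [map_measureReal_apply hm1 hD', map_measureReal_apply hm2 hD'] at h2
  refine (le_of_eq ?_).trans (h2.trans (le_of_eq ?_))
  · simp only [← Set.preimage_comp, Function.comp_def, he, Equiv.symm_apply_apply]
  · rw [← e.sum_comp]
    simp [he]

/-- Local exchangeability for two injective families of covariates that differ in finitely many
places. -/
theorem LocallyExchangeable.abs_real_sub_le_of_eqOn (hexch : LocallyExchangeable P d X)
    (hd : IsPremetric d) (hX : ∀ t, Measurable (X t)) {K : Type*} {s s' : K → 𝒯}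
    (hs : Function.Injective s) (hs' : Function.Injective s') (F : Finset K)
    (hF : ∀ k ∉ F, s k = s' k) {D : Set (K → 𝒳)} (hD : MeasurableSet D) :
    |P.real ((fun ω k => X (s k) ω) ⁻¹' D) - P.real ((fun ω k => X (s' k) ω) ⁻¹' D)|
      ≤ ∑ k ∈ F, d (s k) (s' k) := by
  classical
  have hm : Measurable fun ω k => X (s k) ω := measurable_pi_lambda _ fun t => hX _
  have hm' : Measurable fun ω k => X (s' k) ω := measurable_pi_lambda _ fun t => hX _
  set μ := P.map fun ω k => X (s k) ω with hμ
  set ν := P.map fun ω k => X (s' k) ω with hν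
  have := Measure.isProbabilityMeasure_map (μ := P) hm.aemeasurable
  have := Measure.isProbabilityMeasure_map (μ := P) hm'.aemeasurable
  rw [← map_measureReal_apply hm hD, ← map_measureReal_apply hm' hD, ← hμ, ← hν]
  have hcyl : ∀ E ∈ measurableCylinders (fun _ : K => 𝒳),
      |μ.real E - ν.real E| ≤ ∑ k ∈ F, d (s k) (s' k) := by
    intro E hE
    have hEm := MeasurableSet.of_mem_measurableCylinders hE
    obtain ⟨J, S, hS, rfl⟩ := (mem_measurableCylinders _).1 hE
    rw [hμ, hν, map_measureReal_apply hm hEm, map_measureReal_apply hm' hEm]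
    refine (hexch.abs_real_sub_le hX (κ := J) (s := fun k => s k) (s' := fun k => s' k)
      (hs.comp Subtype.val_injective) (hs'.comp Subtype.val_injective) hS).trans ?_
    rw [Finset.sum_coe_sort J fun k => d (s k) (s' k)]
    calc ∑ k ∈ J, d (s k) (s' k) ≤ ∑ k ∈ J ∪ F, d (s k) (s' k) :=
          Finset.sum_le_sum_of_subset_of_nonneg Finset.subset_union_left
            fun _ _ _ => hd.nonneg _ _
      _ = ∑ k ∈ F, d (s k) (s' k) := by
          refine (Finset.sum_subset Finset.subset_union_right fun k _ hk => ?_).symm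
          rw [hF k hk, hd.self_eq_zero]
  -- Density with respect to the sum gives one cylinder close to D under both laws.
  have hdense := Measure.MeasureDense.of_generateFrom_isSetAlgebra_finite (μ := μ + ν)
    (isSetAlgebra_measurableCylinders (α := fun _ : K => 𝒳)) generateFrom_measurableCylinders.symm
  refine le_of_forall_pos_le_add fun ε hε => ?_
  obtain ⟨E, hE, hDE⟩ := hdense.approx D hD (measure_ne_top _ _) ε hε
  have hEm := MeasurableSet.of_mem_measurableCylinders hE
  have hlt : μ.real (symmDiff D E) + ν.real (symmDiff D E) < ε := by
    rw [← measureReal_add_apply, measureReal_def]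
    exact (ENNReal.toReal_lt_of_lt_ofReal hDE)
  have h1 : |μ.real D - μ.real E| ≤ μ.real (symmDiff D E) :=
    abs_measureReal_sub_le_measureReal_symmDiff hD.nullMeasurableSet hEm.nullMeasurableSet
  have h2 : |ν.real D - ν.real E| ≤ ν.real (symmDiff D E) :=
    abs_measureReal_sub_le_measureReal_symmDiff hD.nullMeasurableSet hEm.nullMeasurableSet
  have h3 := hcyl E hE
  rw [abs_le] at h1 h2 h3 ⊢
  constructor <;> linarith [h1.1, h1.2, h2.1, h2.2, h3.1, h3.2]

/-- Moving finitely many covariates changes the expectation of a bounded function of the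
observations there and of all observations elsewhere by little. -/
theorem LocallyExchangeable.abs_integral_sub_le (hexch : LocallyExchangeable P d X)
    (hd : IsPremetric d) (hX : ∀ t, Measurable (X t)) {ι : Type*} [Fintype ι] {s s' : ι → 𝒯}
    (hs : Function.Injective s) (hs' : Function.Injective s') {R : Set 𝒯}
    (hR : ∀ i, s i ∈ R) (hR' : ∀ i, s' i ∈ R)
    {H : (ι → 𝒳) × ({r // r ∉ R} → 𝒳) → ℝ} (hH : Measurable H)
    {a b : ℝ} (hab : a ≤ b) (ha : ∀ x, a ≤ H x) (hb : ∀ x, H x ≤ b) :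
    |∫ ω, H (fun i => X (s i) ω, rest X R ω) ∂P - ∫ ω, H (fun i => X (s' i) ω, rest X R ω) ∂P|
      ≤ (b - a) * ∑ i, d (s i) (s' i) := by
  classical
  have hm : ∀ u : ι → 𝒯, Measurable fun ω => ((fun i => X (u i) ω, rest X R ω) :
      (ι → 𝒳) × ({r // r ∉ R} → 𝒳)) := fun u =>
    (measurable_pi_lambda _ fun i => hX _).prodMk (measurable_rest hX R)
  have := fun u => Measure.isProbabilityMeasure_map (μ := P) (hm u).aemeasurable
  -- Gluing the moved covariates, all inside R, to the fixed ones outside R keeps the family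
  -- injective, as exchangeability requires.
  have hinj : ∀ u : ι → 𝒯, Function.Injective u → (∀ i, u i ∈ R) →
      Function.Injective (Sum.elim u (Subtype.val : {r // r ∉ R} → 𝒯)) := fun u hu huR =>
    hu.sumElim Subtype.val_injective fun i r h => r.2 (h ▸ huR i)
  rw [← integral_map (hm s).aemeasurable hH.aestronglyMeasurable,
    ← integral_map (hm s').aemeasurable hH.aestronglyMeasurable]
  refine abs_integral_sub_le_of_abs_real_sub_le (fun D hD => ?_) hH hab ha hb
  rw [map_measureReal_apply (hm s) hD, map_measureReal_apply (hm s') hD]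
  have hD' : MeasurableSet ((fun x : ι ⊕ {r // r ∉ R} → 𝒳 =>
      ((fun i => x (Sum.inl i), fun r => x (Sum.inr r)) :
        (ι → 𝒳) × ({r // r ∉ R} → 𝒳))) ⁻¹' D) :=
    ((measurable_pi_lambda _ fun i => measurable_pi_apply _).prodMk
      (measurable_pi_lambda _ fun r => measurable_pi_apply _)) hD
  refine (hexch.abs_real_sub_le_of_eqOn hd hX (hinj s hs hR) (hinj s' hs' hR')
    (Finset.univ.map Function.Embedding.inl) ?_ hD').trans (le_of_eq ?_)
  · rintro (i | r) h
    · simp at h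
    · rfl
  · simp

end LocalExch

end

/-! ### Measurability via uncorrelated approximations, and moving one covariate -/

noncomputable section

namespace LocalExch

theorem exists_measurable_sign :
    ∃ sgn : ℝ → ℝ, Measurable sgn ∧ (∀ x, |sgn x| ≤ 1) ∧ ∀ x, |x| = x * sgn x := by
  refine ⟨fun x => if 0 ≤ x then 1 else -1,
    Measurable.ite measurableSet_Ici measurable_const measurable_const, fun x => ?_, fun x => ?_⟩
  · by_cases hx : 0 ≤ x <;> simp [hx]
  · by_cases hx : 0 ≤ x
    · simp [hx, abs_of_nonneg hx]
    · simp [hx, abs_of_neg (not_le.1 hx)]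

section General

variable {Ω : Type*} {m : MeasurableSpace Ω} [m0 : MeasurableSpace Ω] {P : Measure Ω}

/-- An integrable function that can be approximated in `L¹` by `m`-measurable functions is almost
surely equal to its conditional expectation given `m`. -/
theorem ae_eq_condExp_of_forall_exists_integral_abs_sub_le [IsProbabilityMeasure P] (hm : m ≤ m0)
    {Z : Ω → ℝ} (hZ : Integrable Z P)
    (h : ∀ ε > 0, ∃ M : Ω → ℝ, StronglyMeasurable[m] M ∧ Integrable M P ∧
      ∫ ω, |Z ω - M ω| ∂P ≤ ε) : Z =ᵐ[P] P[Z | m] := by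
  have hle : ∫ ω, |Z ω - (P[Z | m]) ω| ∂P ≤ 0 := by
    refine le_of_forall_pos_le_add fun ε hε => ?_
    -- The error is spent twice: once for Z - M, and once for its conditional expectation, a
    -- contraction in L¹.
    obtain ⟨M, hM, hMi, hMε⟩ := h (ε / 2) (half_pos hε)
    have h1 : P[fun ω => Z ω - M ω | m] =ᵐ[P] fun ω => (P[Z | m]) ω - M ω := by
      filter_upwards [condExp_sub hZ hMi m] with ω hω
      rw [show (fun ω => Z ω - M ω) = Z - M from rfl, hω, Pi.sub_apply,
        condExp_of_stronglyMeasurable hm hM hMi]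
    have h2 : ∫ ω, |(P[Z | m]) ω - M ω| ∂P ≤ ε / 2 := by
      refine le_trans (le_of_eq ?_) ((integral_abs_condExp_le (m := m) fun ω => Z ω - M ω).trans hMε)
      refine integral_congr_ae ?_
      filter_upwards [h1] with ω hω
      rw [hω]
    calc ∫ ω, |Z ω - (P[Z | m]) ω| ∂P
        ≤ ∫ ω, (|Z ω - M ω| + |(P[Z | m]) ω - M ω|) ∂P := by
          refine integral_mono (hZ.sub integrable_condExp).abs
            ((hZ.sub hMi).abs.add (integrable_condExp.sub hMi).abs) fun ω => ?_
          simp only [abs_sub_comm ((P[Z | m]) ω)]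
          exact abs_sub_le _ _ _
      _ = ∫ ω, |Z ω - M ω| ∂P + ∫ ω, |(P[Z | m]) ω - M ω| ∂P :=
          integral_add (hZ.sub hMi).abs (integrable_condExp.sub hMi).abs
      _ ≤ 0 + ε := by linarith
  have h0 := (integral_eq_zero_iff_of_nonneg (fun ω => abs_nonneg (Z ω - (P[Z | m]) ω))
    (hZ.sub integrable_condExp).abs).1 (le_antisymm hle (integral_nonneg fun ω => abs_nonneg _))
  filter_upwards [h0] with ω hω
  exact sub_eq_zero.1 (abs_eq_zero.1 hω)

/-- If `[0, 1]`-valued random variables `f i`, eventually `m`-measurable, are asymptotically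
uncorrelated around `Z`, then `Z` is almost surely `m`-measurable. -/
theorem aestronglyMeasurable_of_forall_integral_mul_le [IsProbabilityMeasure P] (hm : m ≤ m0)
    {Z : Ω → ℝ} (hZ : Measurable Z) (hZ0 : ∀ ω, 0 ≤ Z ω) (hZ1 : ∀ ω, Z ω ≤ 1) {f : ℕ → Ω → ℝ}
    (hf : ∀ᶠ i in atTop, Measurable[m] (f i)) (hf0 : ∀ i ω, 0 ≤ f i ω) (hf1 : ∀ i ω, f i ω ≤ 1)
    (h : ∀ ε > 0, ∃ K, ∀ i ≥ K, ∀ j ≥ K, i ≠ j →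
      ∫ ω, (f i ω - Z ω) * (f j ω - Z ω) ∂P ≤ ε) : AEStronglyMeasurable[m] Z P := by
  have hZi : Integrable Z P := Integrable.of_bound hZ.aestronglyMeasurable 1
    (ae_of_all _ fun ω => by rw [Real.norm_of_nonneg (hZ0 ω)]; exact hZ1 ω)
  refine stronglyMeasurable_condExp.aestronglyMeasurable.congr
    (ae_eq_condExp_of_forall_exists_integral_abs_sub_le hm hZi fun ε hε => ?_).symm
  -- The mean square error of an average of n tail terms splits into off-diagonal terms,
  -- contributing at most ε²/8, and the diagonal, contributing at most 1/n ≤ ε²/8.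
  obtain ⟨K, hK⟩ := h (ε ^ 2 / 8) (by positivity)
  obtain ⟨K', hK'⟩ := eventually_atTop.1 hf
  obtain ⟨n, hn⟩ := exists_nat_gt (8 / ε ^ 2)
  have hn0 : (0 : ℝ) < n := lt_trans (by positivity) hn
  set L := max K K'
  have hfm : ∀ i, Measurable[m] (f (L + i)) := fun i =>
    hK' _ ((le_max_right _ _).trans (Nat.le_add_right _ _))
  have hfm0 : ∀ i, Measurable (f (L + i)) := fun i => (hfm i).mono hm le_rfl
  let M : Ω → ℝ := fun ω => (n : ℝ)⁻¹ * ∑ i ∈ Finset.range n, f (L + i) ω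
  have hMm : Measurable[m] M :=
    Measurable.const_mul (Finset.measurable_sum _ fun i _ => hfm i) _
  have hgi : ∀ i j, Integrable (fun ω => (f (L + i) ω - Z ω) * (f (L + j) ω - Z ω)) P := by
    intro i j
    refine Integrable.of_bound (((hfm0 i).sub hZ).mul ((hfm0 j).sub hZ)).aestronglyMeasurable 1
      (ae_of_all _ fun ω => ?_)
    rw [Real.norm_eq_abs, abs_mul]
    refine mul_le_one₀ ?_ (abs_nonneg _) ?_ <;> rw [abs_le] <;> constructor <;>
      linarith [hf0 (L + i) ω, hf1 (L + i) ω, hf0 (L + j) ω, hf1 (L + j) ω, hZ0 ω, hZ1 ω]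
  have hMi : Integrable M P := by
    refine Integrable.const_mul (integrable_finsetSum _ fun i _ => ?_) _
    exact Integrable.of_bound (hfm0 i).aestronglyMeasurable 1 (ae_of_all _ fun ω => by
      rw [Real.norm_of_nonneg (hf0 _ ω)]; exact hf1 _ ω)
  have hsq : ∀ ω, (Z ω - M ω) ^ 2 = ((n : ℝ)⁻¹) ^ 2 * ∑ i ∈ Finset.range n,
      ∑ j ∈ Finset.range n, (f (L + i) ω - Z ω) * (f (L + j) ω - Z ω) := by
    intro ω
    rw [← Finset.sum_mul_sum, ← pow_two, ← mul_pow, Finset.sum_sub_distrib, ← neg_sq, neg_sub]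
    congr 1
    simp only [M, Finset.sum_const, Finset.card_range, nsmul_eq_mul]
    field_simp
  have hsqi : Integrable (fun ω => (Z ω - M ω) ^ 2) P := by
    simp only [hsq]
    exact Integrable.const_mul (integrable_finsetSum _ fun i _ =>
      integrable_finsetSum _ fun j _ => hgi i j) _
  have hterm : ∀ i j, ∫ ω, (f (L + i) ω - Z ω) * (f (L + j) ω - Z ω) ∂P
      ≤ ε ^ 2 / 8 + if i = j then 1 else 0 := by
    intro i j
    split_ifs with hij
    · refine le_trans (integral_mono (hgi i j) (integrable_const 1) fun ω => ?_) ?_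
      · subst hij
        have := hf0 (L + i) ω
        have := hf1 (L + i) ω
        have := hZ0 ω
        have := hZ1 ω
        dsimp only
        nlinarith
      · simp only [integral_const, probReal_univ, smul_eq_mul, mul_one]
        have : 0 < ε ^ 2 := by positivity
        linarith
    · rw [add_zero]
      have hL : ∀ i, L + i ≥ K := fun i => (le_max_left _ _).trans (Nat.le_add_right _ _)
      exact hK _ (hL i) _ (hL j) fun h' => hij (Nat.add_left_cancel h')
  have hvar : ∫ ω, (Z ω - M ω) ^ 2 ∂P ≤ ε ^ 2 / 4 := by
    simp only [hsq]
    rw [integral_const_mul, integral_finsetSum _ fun i _ => integrable_finsetSum _ fun j _ => hgi i j]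
    simp_rw [integral_finsetSum (Finset.range n) fun j _ => hgi _ j]
    calc ((n : ℝ)⁻¹) ^ 2 * ∑ i ∈ Finset.range n, ∑ j ∈ Finset.range n,
          ∫ ω, (f (L + i) ω - Z ω) * (f (L + j) ω - Z ω) ∂P
        ≤ ((n : ℝ)⁻¹) ^ 2 * ∑ i ∈ Finset.range n, ∑ j ∈ Finset.range n,
          (ε ^ 2 / 8 + if i = j then 1 else 0) := by
          gcongr with i _ j _
          exact hterm i j
      _ = ε ^ 2 / 8 + (n : ℝ)⁻¹ := by
          have : ∀ i ∈ Finset.range n, ∑ j ∈ Finset.range n, (ε ^ 2 / 8 + if i = j then (1 : ℝ) else 0)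
              = n * (ε ^ 2 / 8) + 1 := by
            intro i hi
            rw [Finset.sum_add_distrib, Finset.sum_ite_eq, if_pos hi]
            simp
          rw [Finset.sum_congr rfl this]
          simp only [Finset.sum_const, Finset.card_range, nsmul_eq_mul]
          field_simp
      _ ≤ ε ^ 2 / 4 := by
          have : (n : ℝ)⁻¹ ≤ ε ^ 2 / 8 := by
            rw [inv_le_comm₀ hn0 (by positivity), inv_div]
            exact hn.le
          linarith
  refine ⟨M, hMm.stronglyMeasurable, hMi, ?_⟩
  -- Expanding (|Z - M| - ε)² ≥ 0 passes from the mean square bound ε²/4 to the L¹ bound ε/2 + ε/8.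
  have hpt : ∀ ω, |Z ω - M ω| ≤ ε / 2 + (2 * ε)⁻¹ * (Z ω - M ω) ^ 2 := by
    intro ω
    rw [← sq_abs (Z ω - M ω)]
    have h2 : 0 ≤ (2 * ε)⁻¹ * (|Z ω - M ω| - ε) ^ 2 := by positivity
    have h3 : (2 * ε)⁻¹ * (|Z ω - M ω| - ε) ^ 2
        = (2 * ε)⁻¹ * |Z ω - M ω| ^ 2 - |Z ω - M ω| + ε / 2 := by field_simp; ring
    linarith
  calc ∫ ω, |Z ω - M ω| ∂P ≤ ∫ ω, (ε / 2 + (2 * ε)⁻¹ * (Z ω - M ω) ^ 2) ∂P :=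
        integral_mono (hZi.sub hMi).abs ((integrable_const _).add (hsqi.const_mul _)) hpt
    _ = ε / 2 + (2 * ε)⁻¹ * ∫ ω, (Z ω - M ω) ^ 2 ∂P := by
        rw [integral_add (integrable_const _) (hsqi.const_mul _), integral_const_mul]
        simp
    _ ≤ ε / 2 + (2 * ε)⁻¹ * (ε ^ 2 / 4) := by gcongr
    _ ≤ ε := by
        have : (2 * ε)⁻¹ * (ε ^ 2 / 4) = ε / 8 := by field_simp; ring
        linarith

/-- A conditional expectation may be replaced by the function under an integral against a bounded
almost surely measurable factor. -/
theorem integral_condExp_mul_of_bound [IsProbabilityMeasure P] (hm : m ≤ m0) {f g : Ω → ℝ}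
    (hf : Integrable f P) (hg : AEStronglyMeasurable[m] g P) {C : ℝ} (hC : ∀ᵐ ω ∂P, |g ω| ≤ C) :
    ∫ ω, (P[f | m]) ω * g ω ∂P = ∫ ω, f ω * g ω ∂P := by
  have hfg : Integrable (f * g) P := hf.mul_bdd (hg.mono hm) hC
  rw [show (fun ω => f ω * g ω) = f * g from rfl, ← integral_condExp hm (f := f * g)]
  exact integral_congr_ae (condExp_mul_of_aestronglyMeasurable_right hg hfg hf).symm

/-- A bounded function that is almost surely measurable with respect to `Y` is almost surely a
bounded measurable function of `Y`. -/
theorem exists_ae_eq_comp_of_bound {β : Type*} [MeasurableSpace β] {Y : Ω → β}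
    {g : Ω → ℝ} (hg : AEStronglyMeasurable[MeasurableSpace.comap Y inferInstance] g P)
    {C : ℝ} (hC0 : 0 ≤ C) (hC : ∀ᵐ ω ∂P, |g ω| ≤ C) :
    ∃ ψ : β → ℝ, Measurable ψ ∧ (∀ y, |ψ y| ≤ C) ∧ g =ᵐ[P] fun ω => ψ (Y ω) := by
  obtain ⟨g', hg', hgg'⟩ := hg
  obtain ⟨ψ, hψ, rfl⟩ := hg'.exists_eq_measurable_comp
  -- Truncation makes the bound hold everywhere and changes nothing where |g| ≤ C.
  refine ⟨fun y => max (-C) (min C (ψ y)), ?_, fun y => ?_, ?_⟩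
  · exact measurable_const.max (measurable_const.min hψ.measurable)
  · rw [abs_le]
    exact ⟨le_max_left _ _, max_le (by linarith) (min_le_left _ _)⟩
  · filter_upwards [hgg', hC] with ω h1 h2
    rw [abs_le] at h2
    have h3 : ψ (Y ω) = g ω := h1.symm
    simp only [h3, min_eq_right h2.2, max_eq_right h2.1]

end General

/-- Infinitely many values remain after `t` is removed. One index chosen for each of them gives an
injective sequence of indices, which tends to infinity, so the convergence survives. -/
theorem InfinitelySeparable.exists_injective_tendsto {𝒯 : Type*} {d : 𝒯 → 𝒯 → ℝ}
    (h : InfinitelySeparable d) (t : 𝒯) :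
    ∃ u : ℕ → 𝒯, Function.Injective u ∧ (∀ n, u n ≠ t) ∧ Tendsto (fun n => d (u n) t) atTop (𝓝 0) := by
  obtain ⟨S, -, hS⟩ := h
  obtain ⟨v, -, -, hv, hinf⟩ := hS t
  have hinf' : (Set.range v \ {t}).Infinite := hinf.sdiff (Set.finite_singleton t)
  let e := hinf'.natEmbedding
  choose n hn using fun k => (e k).2.1
  have he : Function.Injective fun k => (e k : 𝒯) := Subtype.val_injective.comp e.injective
  have hninj : Function.Injective n := fun a b hab => he (by simp only [← hn, hab])
  refine ⟨fun k => e k, he, fun k => (e k).2.2, ?_⟩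
  simp_rw [← hn]
  exact hv.comp hninj.nat_tendsto_atTop

/-- The indicator of the event that the observation at `t` lies in `A`. -/
def hit {𝒯 Ω 𝒳 : Type*} (X : 𝒯 → Ω → 𝒳) (A : Set 𝒳) (t : 𝒯) : Ω → ℝ :=
  (X t ⁻¹' A).indicator fun _ => 1

section Hit

variable {𝒯 Ω 𝒳 : Type*} {X : 𝒯 → Ω → 𝒳} {A : Set 𝒳}

theorem hit_eq (t : 𝒯) (ω : Ω) : hit X A t ω = A.indicator (fun _ => 1) (X t ω) := by
  classical
  simp [hit, Set.indicator_apply]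

theorem hit_nonneg (t : 𝒯) (ω : Ω) : 0 ≤ hit X A t ω :=
  Set.indicator_nonneg (fun _ _ => zero_le_one) ω

theorem hit_le_one (t : 𝒯) (ω : Ω) : hit X A t ω ≤ 1 :=
  Set.indicator_le_self' (fun _ _ => zero_le_one) ω

theorem abs_hit_le_one (t : 𝒯) (ω : Ω) : |hit X A t ω| ≤ 1 := by
  rw [abs_of_nonneg (hit_nonneg t ω)]
  exact hit_le_one t ω

theorem measurable_hit [MeasurableSpace 𝒳] {m : MeasurableSpace Ω} {t : 𝒯}
    (ht : Measurable[m] (X t)) (hA : MeasurableSet A) : Measurable[m] (hit X A t) :=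
  measurable_const.indicator (ht hA)

end Hit

variable {𝒯 Ω 𝒳 : Type*} [MeasurableSpace Ω] [MeasurableSpace 𝒳]
  {P : Measure Ω} [IsProbabilityMeasure P] {d : 𝒯 → 𝒯 → ℝ} {X : 𝒯 → Ω → 𝒳}

theorem integrable_hit (hX : ∀ t, Measurable (X t)) {A : Set 𝒳} (hA : MeasurableSet A) (t : 𝒯) :
    Integrable (hit X A t) P :=
  Integrable.of_bound (measurable_hit (hX t) hA).aestronglyMeasurable 1
    (ae_of_all _ fun ω => abs_hit_le_one t ω)

/-- Moving one covariate from `t` to `u` changes the probability of an event there, weighted by a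
function of the observations elsewhere, by at most `d t u`. -/
theorem LocallyExchangeable.abs_integral_hit_mul_sub_le (hexch : LocallyExchangeable P d X)
    (hd : IsPremetric d) (hX : ∀ t, Measurable (X t)) {A : Set 𝒳} (hA : MeasurableSet A) (t u : 𝒯)
    {φ : Ω → ℝ} (hφ : AEStronglyMeasurable[restSigma X {t, u}] φ P) (hφ1 : ∀ᵐ ω ∂P, |φ ω| ≤ 1) :
    |∫ ω, hit X A t ω * φ ω ∂P - ∫ ω, hit X A u ω * φ ω ∂P| ≤ d t u := by
  obtain ⟨ψ, hψ, hψ1, hφψ⟩ := exists_ae_eq_comp_of_bound hφ zero_le_one hφ1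
  -- Centring the indicator at 1/2 subtracts the same constant from both integrals and brings the
  -- oscillation down to 1, so the bound is d t u and not 2 d t u.
  let H : (Unit → 𝒳) × ({r // r ∉ ({t, u} : Set 𝒯)} → 𝒳) → ℝ := fun x =>
    (A.indicator (fun _ => 1) (x.1 ()) - 1 / 2) * ψ x.2
  have hH : Measurable H := ((((measurable_const (a := (1 : ℝ))).indicator hA).comp
    ((measurable_pi_apply ()).comp measurable_fst)).sub_const _).mul (hψ.comp measurable_snd)
  have hHb : ∀ x, |H x| ≤ 1 / 2 := by
    intro x
    simp only [H, abs_mul]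
    have h1 : |A.indicator (fun _ => (1 : ℝ)) (x.1 ()) - 1 / 2| = 1 / 2 := by
      by_cases hx : x.1 () ∈ A
      · rw [Set.indicator_of_mem hx]; norm_num
      · rw [Set.indicator_of_notMem hx]; norm_num
    rw [h1]
    nlinarith [hψ1 x.2, abs_nonneg (ψ x.2)]
  have key := hexch.abs_integral_sub_le hd hX (ι := Unit) (s := fun _ => t) (s' := fun _ => u)
    (R := {t, u}) (Function.injective_of_subsingleton _) (Function.injective_of_subsingleton _)
    (by simp) (by simp) hH (a := -(1 / 2)) (b := 1 / 2) (by norm_num)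
    (fun x => (abs_le.1 (hHb x)).1) (fun x => (abs_le.1 (hHb x)).2)
  have hψi : Integrable (fun ω => ψ (rest X {t, u} ω)) P :=
    Integrable.of_bound (hψ.comp (measurable_rest hX _)).aestronglyMeasurable 1
      (ae_of_all _ fun ω => hψ1 _)
  have hint : ∀ s, ∫ ω, H (fun _ => X s ω, rest X {t, u} ω) ∂P
      = ∫ ω, hit X A s ω * φ ω ∂P - 1 / 2 * ∫ ω, φ ω ∂P := by
    intro s
    have h1 : ∫ ω, hit X A s ω * φ ω ∂P = ∫ ω, hit X A s ω * ψ (rest X {t, u} ω) ∂P :=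
      integral_congr_ae (hφψ.mono fun ω hω => by simp only [hω])
    rw [integral_congr_ae hφψ, h1, ← integral_const_mul, ← integral_sub]
    · refine integral_congr_ae (ae_of_all _ fun ω => ?_)
      simp only [H, hit_eq]
      ring
    · exact hψi.bdd_mul (measurable_hit (hX s) hA).aestronglyMeasurable
        (ae_of_all _ fun ω => abs_hit_le_one s ω)
    · exact hψi.const_mul _
  rw [hint, hint, sub_sub_sub_cancel_right] at key
  simpa using key.trans (by norm_num)

end LocalExch

end

/-! ### Null-set modifications, and conditional independence from one-point conditional laws -/

noncomputable section

namespace LocalExch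

/-- Functions measurable with respect to a σ-algebra contained in `m` up to null sets are almost
surely `m`-measurable. -/
theorem aestronglyMeasurable_of_le_eventuallyMeasurableSpace {Ω : Type*} {m : MeasurableSpace Ω}
    [MeasurableSpace Ω] {P : Measure Ω} {m' : MeasurableSpace Ω} (h : m' ≤ eventuallyMeasurableSpace m (ae P))
    {g : Ω → ℝ} (hg : Measurable[m'] g) : AEStronglyMeasurable[m] g P := by
  have hsimple : ∀ f : SimpleFunc Ω ℝ, ∃ f' : Ω → ℝ, StronglyMeasurable[m] f' ∧ f =ᵐ[P] f' := by
    intro f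
    refine SimpleFunc.induction (motive := fun f : SimpleFunc Ω ℝ =>
      ∃ f' : Ω → ℝ, StronglyMeasurable[m] f' ∧ f =ᵐ[P] f') (fun c s hs => ?_)
      (fun f₁ f₂ _ h₁ h₂ => ?_) f
    · obtain ⟨B, hB, hsB⟩ := h _ hs
      refine ⟨B.indicator fun _ => c, stronglyMeasurable_const.indicator hB, ?_⟩
      filter_upwards [hsB] with ω hω
      have hω' : ω ∈ s ↔ ω ∈ B := iff_of_eq hω
      by_cases hωs : ω ∈ s
      · simp [hωs, hω'.1 hωs]
      · simp [hωs, mt hω'.2 hωs]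
    · obtain ⟨f₁', hm₁, he₁⟩ := h₁
      obtain ⟨f₂', hm₂, he₂⟩ := h₂
      exact ⟨f₁' + f₂', hm₁.add hm₂, he₁.add he₂⟩
  have hs := hg.stronglyMeasurable
  choose g' hg' hgg' using fun n => hsimple (hs.approx n)
  -- The `m`-measurable versions of the simple approximations need converge only almost everywhere;
  -- elsewhere the default value of `limUnder` is harmless.
  refine ⟨fun ω => limUnder atTop fun n => g' n ω, 
    @StronglyMeasurable.limUnder _ _ _ m _ _ _ _ _ _ _ hg', ?_⟩
  filter_upwards [ae_all_iff.2 hgg'] with ω hω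
  refine (Tendsto.limUnder_eq ?_).symm
  simpa only [hω] using hs.tendsto_approx ω

section ProcessSigma

variable {𝒯 Ω 𝒳 : Type*} [MeasurableSpace Ω] [MeasurableSpace 𝒳] {G : 𝒯 → Kernel Ω 𝒳}

theorem processSigma_le : processSigma G ≤ ‹MeasurableSpace Ω› :=
  iSup_le fun t => (G t).measurable.comap_le

theorem measurable_processSigma_apply (t : 𝒯) {A : Set 𝒳} (hA : MeasurableSet A) :
    Measurable[processSigma G] fun ω => G t ω A :=
  (Measure.measurable_coe hA).comp
    ((comap_measurable (fun ω => G t ω)).mono (le_iSup (fun t => MeasurableSpace.comap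
      (fun ω => G t ω) inferInstance) t) le_rfl)

theorem measurable_processSigma_real (t : 𝒯) {A : Set 𝒳} (hA : MeasurableSet A) :
    Measurable[processSigma G] fun ω => (G t ω).real A :=
  ENNReal.measurable_toReal.comp (measurable_processSigma_apply t hA)

theorem measurable_processSigma_pi (hG : ∀ t, IsMarkovKernel (G t)) (T : Finset 𝒯) :
    Measurable[processSigma G] fun ω => Measure.pi fun t : T => G t ω := by
  refine @Measurable.measure_of_isPiSystem_of_isProbabilityMeasure _ _ (processSigma G) _ _ _ _
    generateFrom_pi.symm isPiSystem_pi ?_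
  rintro _ ⟨s, hs, rfl⟩
  simp only [Measure.pi_pi]
  exact @Finset.measurable_prod _ _ _ _ _ _ (processSigma G) _ _ fun t _ =>
    measurable_processSigma_apply _ (hs t trivial)

/-- The exceptional null sets depend on `t` and `A`, and there may be uncountably many of them. The
sets that agree a.e. with a set of `m` form a σ-algebra, so each evaluation can be corrected
separately and no common null set is needed. -/
theorem processSigma_le_eventuallyMeasurableSpace {𝒯 Ω 𝒳 : Type*} {m : MeasurableSpace Ω}
    [MeasurableSpace Ω] [MeasurableSpace 𝒳] {G : 𝒯 → Kernel Ω 𝒳} {P : Measure Ω}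
    (hG : ∀ t, IsMarkovKernel (G t))
    (h : ∀ t A, MeasurableSet A → AEStronglyMeasurable[m] (fun ω => (G t ω).real A) P) :
    processSigma G ≤ eventuallyMeasurableSpace m (ae P) := by
  refine iSup_le fun t => Measurable.comap_le ?_
  refine @Measure.measurable_of_measurable_coe _ _ _ (eventuallyMeasurableSpace m (ae P)) _
    fun A hA => ?_
  obtain ⟨g, hg, hGg⟩ := h t A hA
  have h1 : EventuallyMeasurable m (ae P) fun ω => (G t ω).real A :=
    hg.measurable.eventuallyMeasurable_of_eventuallyEq hGg
  have h2 : (fun ω => G t ω A) = fun ω => ENNReal.ofReal ((G t ω).real A) :=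
    funext fun ω => (ENNReal.ofReal_toReal (measure_ne_top _ _)).symm
  rw [h2]
  exact ENNReal.measurable_ofReal.comp h1

end ProcessSigma

variable {𝒯 Ω 𝒳 : Type*} [MeasurableSpace Ω] [MeasurableSpace 𝒳]
  {P : Measure Ω} {d : 𝒯 → 𝒯 → ℝ} {X : 𝒯 → Ω → 𝒳}

theorem abs_kernel_real_le_one {G : 𝒯 → Kernel Ω 𝒳} (hG : ∀ t, IsMarkovKernel (G t)) (t : 𝒯)
    (A : Set 𝒳) (ω : Ω) : |(G t ω).real A| ≤ 1 := by
  rw [abs_of_nonneg measureReal_nonneg]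
  exact measureReal_le_one

/-- If each `G t` is the conditional law of `X t` given the other observations and is measurable
with respect to them after removing any further covariate, then the observations are conditionally
independent given `G`. -/
theorem integral_prod_hit_mul {G : 𝒯 → Kernel Ω 𝒳}
    (hG : ∀ t, IsMarkovKernel (G t))
    (hrest : ∀ s t A, MeasurableSet A →
      AEStronglyMeasurable[restSigma X {s}] (fun ω => (G t ω).real A) P)
    (hlaw : ∀ t A, MeasurableSet A → ∀ g : Ω → ℝ, AEStronglyMeasurable[restSigma X {t}] g P →
      (∀ ω, |g ω| ≤ 1) → ∫ ω, hit X A t ω * g ω ∂P = ∫ ω, (G t ω).real A * g ω ∂P)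
    {A : 𝒯 → Set 𝒳} (hA : ∀ t, MeasurableSet (A t)) (T : Finset 𝒯) {g : Ω → ℝ}
    (hg : Measurable[processSigma G] g) (hg1 : ∀ ω, |g ω| ≤ 1) :
    ∫ ω, (∏ t ∈ T, hit X (A t) t ω) * g ω ∂P
      = ∫ ω, (∏ t ∈ T, (G t ω).real (A t)) * g ω ∂P := by
  classical
  induction T using Finset.induction_on generalizing g with
  | empty => rfl
  | insert t T ht ih =>
    simp only [Finset.prod_insert ht]
    -- The weight depends on G alone, hence a.s. only on the observations off t, as do the remaining
    -- factors. So the factor at t can be replaced by G_t, which then joins the weight in the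
    -- induction hypothesis.
    have hgt := aestronglyMeasurable_of_le_eventuallyMeasurableSpace
      (processSigma_le_eventuallyMeasurableSpace hG (hrest t)) hg
    have hp : Measurable[restSigma X {t}] fun ω => ∏ s ∈ T, hit X (A s) s ω :=
      Finset.measurable_prod _ fun s hs => measurable_hit
        (measurable_restSigma (by rintro rfl; exact ht hs)) (hA s)
    have hp1 : ∀ ω, |∏ s ∈ T, hit X (A s) s ω| ≤ 1 := fun ω => by
      rw [Finset.abs_prod]
      exact Finset.prod_le_one (fun _ _ => abs_nonneg _) fun s _ => abs_hit_le_one s ω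
    have h1 := hlaw t (A t) (hA t) (fun ω => (∏ s ∈ T, hit X (A s) s ω) * g ω)
      (hp.stronglyMeasurable.aestronglyMeasurable.mul hgt) fun ω => by
        rw [abs_mul]
        exact mul_le_one₀ (hp1 ω) (abs_nonneg _) (hg1 ω)
    have h2 := ih (g := fun ω => (G t ω).real (A t) * g ω)
      ((measurable_processSigma_real t (hA t)).mul hg) fun ω => by
        rw [abs_mul]
        exact mul_le_one₀ (abs_kernel_real_le_one hG t _ ω) (abs_nonneg _) (hg1 ω)
    calc _ = ∫ ω, hit X (A t) t ω * ((∏ s ∈ T, hit X (A s) s ω) * g ω) ∂P := by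
          simp only [mul_assoc]
      _ = ∫ ω, (G t ω).real (A t) * ((∏ s ∈ T, hit X (A s) s ω) * g ω) ∂P := h1
      _ = ∫ ω, (∏ s ∈ T, hit X (A s) s ω) * ((G t ω).real (A t) * g ω) ∂P := by
          simp only [mul_left_comm]
      _ = _ := h2
      _ = _ := by simp only [mul_left_comm, mul_assoc]

variable [IsProbabilityMeasure P]

/-- On each event D of σ(G), the restricted law of X_T and the mixture over D of the product
measures are finite measures that agree on rectangles, so they agree by the π-λ theorem. -/
theorem condExp_eq_pi_of_integral_prod_hit_mul (hX : ∀ t, Measurable (X t)) {G : 𝒯 → Kernel Ω 𝒳}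
    (hG : ∀ t, IsMarkovKernel (G t))
    (h : ∀ A : 𝒯 → Set 𝒳, (∀ t, MeasurableSet (A t)) → ∀ (T : Finset 𝒯) (g : Ω → ℝ),
      Measurable[processSigma G] g → (∀ ω, |g ω| ≤ 1) →
      ∫ ω, (∏ t ∈ T, hit X (A t) t ω) * g ω ∂P
        = ∫ ω, (∏ t ∈ T, (G t ω).real (A t)) * g ω ∂P)
    (T : Finset 𝒯) {B : Set (T → 𝒳)} (hB : MeasurableSet B) :
    P[((fun ω (t : T) => X t ω) ⁻¹' B).indicator (fun _ => (1 : ℝ)) | processSigma G]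
      =ᵐ[P] fun ω => (Measure.pi fun t : T => G t ω).real B := by
  classical
  have hXT : Measurable fun ω (t : T) => X t ω := measurable_pi_lambda _ fun t => hX _
  have hpi := measurable_processSigma_pi hG T
  have hpi0 : Measurable fun ω => Measure.pi fun t : T => G t ω := hpi.mono processSigma_le le_rfl
  have hreal : Measurable[processSigma G] fun ω => (Measure.pi fun t : T => G t ω).real B :=
    ENNReal.measurable_toReal.comp ((Measure.measurable_coe hB).comp hpi)
  have hreali : Integrable (fun ω => (Measure.pi fun t : T => G t ω).real B) P :=
    Integrable.of_bound (hreal.mono processSigma_le le_rfl).aestronglyMeasurable 1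
      (ae_of_all _ fun ω => by
        rw [Real.norm_of_nonneg measureReal_nonneg]; exact measureReal_le_one)
  refine (ae_eq_condExp_of_forall_setIntegral_eq processSigma_le
    ((integrable_const (1 : ℝ)).indicator (hXT hB)) (fun _ _ _ => hreali.integrableOn)
    (fun D hD _ => ?_) hreal.stronglyMeasurable.aestronglyMeasurable).symm
  have hD0 : MeasurableSet D := processSigma_le D hD
  have hν : ∀ S, MeasurableSet S → (P.restrict D).bind (fun ω => Measure.pi fun t : T => G t ω) S
      = ∫⁻ ω in D, (Measure.pi fun t : T => G t ω) S ∂P := fun S hS =>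
    Measure.bind_apply hS hpi0.aemeasurable
  have hfin : ∀ S, ∫⁻ ω in D, (Measure.pi fun t : T => G t ω) S ∂P ≠ ⊤ := fun S => by
    refine ((lintegral_mono fun ω => prob_le_one).trans_lt ?_).ne
    simp
  have hrealint : ∀ S, MeasurableSet S → ∫ ω in D, (Measure.pi fun t : T => G t ω).real S ∂P
      = (∫⁻ ω in D, (Measure.pi fun t : T => G t ω) S ∂P).toReal := fun S hS =>
    integral_toReal ((Measure.measurable_coe hS).comp hpi0).aemeasurable
      (ae_of_all _ fun ω => measure_lt_top _ _)
  have key : (P.restrict D).map (fun ω (t : T) => X t ω)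
      = (P.restrict D).bind (fun ω => Measure.pi fun t : T => G t ω) := by
    refine ext_of_generate_finite _ generateFrom_pi.symm isPiSystem_pi ?_ ?_
    · rintro _ ⟨s, hs, rfl⟩
      have hs' : ∀ t, MeasurableSet (s t) := fun t => hs t trivial
      have hSm : MeasurableSet (Set.univ.pi s) := MeasurableSet.univ_pi hs'
      rw [hν _ hSm, Measure.map_apply hXT hSm, Measure.restrict_apply (hXT hSm),
        ← ENNReal.toReal_eq_toReal_iff' (measure_ne_top _ _) (hfin _), ← hrealint _ hSm]
      -- The hypothesis takes sides indexed by all of 𝒯; those off T do not enter the product.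
      let A : 𝒯 → Set 𝒳 := fun t => if ht : t ∈ T then s ⟨t, ht⟩ else Set.univ
      have hAs : ∀ t : T, A t = s t := fun t => by simp [A]
      have hA : ∀ t, MeasurableSet (A t) := fun t => by
        by_cases ht : t ∈ T
        · simpa [A, ht] using hs' _
        · simp [A, ht]
      have h1 := h A hA T (D.indicator fun _ => 1) (measurable_const.indicator hD) fun ω => by
        by_cases hω : ω ∈ D <;> simp [hω]
      have h2 : ∀ ω, (∏ t ∈ T, hit X (A t) t ω) * D.indicator (fun _ => (1 : ℝ)) ω
          = ((fun ω (t : T) => X t ω) ⁻¹' Set.univ.pi s ∩ D).indicator (fun _ => (1 : ℝ)) ω := by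
        intro ω
        rw [← Finset.prod_coe_sort T fun t => hit X (A t) t ω]
        simp only [hit_eq, hAs]
        by_cases hω : ω ∈ D
        · by_cases hω' : ∀ t : T, X t ω ∈ s t
          · rw [Finset.prod_eq_one fun t _ => Set.indicator_of_mem (hω' t) _,
              Set.indicator_of_mem hω, Set.indicator_of_mem (show ω ∈ (fun ω (t : T) => X t ω) ⁻¹' Set.univ.pi s ∩ D from
                ⟨fun t _ => hω' t, hω⟩), one_mul]
          · have hn : ω ∉ (fun ω (t : T) => X t ω) ⁻¹' Set.univ.pi s ∩ D :=
              fun hm => hω' fun t => hm.1 t trivial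
            obtain ⟨t, ht⟩ := not_forall.1 hω'
            rw [Finset.prod_eq_zero (Finset.mem_univ t) (Set.indicator_of_notMem ht _), zero_mul,
              Set.indicator_of_notMem hn]
        · rw [Set.indicator_of_notMem hω, Set.indicator_of_notMem fun hm => hω hm.2, mul_zero]
      have h3 : ∀ ω, (∏ t ∈ T, (G t ω).real (A t)) * D.indicator (fun _ => (1 : ℝ)) ω
          = D.indicator (fun ω => (Measure.pi fun t : T => G t ω).real (Set.univ.pi s)) ω := by
        intro ω
        by_cases hω : ω ∈ D
        · rw [Set.indicator_of_mem hω, Set.indicator_of_mem hω, mul_one, measureReal_def,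
            Measure.pi_pi, ENNReal.toReal_prod, ← Finset.prod_coe_sort T]
          simp only [hAs, measureReal_def]
        · rw [Set.indicator_of_notMem hω, Set.indicator_of_notMem hω, mul_zero]
      simp only [h2, h3] at h1
      rw [integral_indicator hD0, integral_indicator_const _ ((hXT hSm).inter hD0), smul_eq_mul,
        mul_one] at h1
      exact h1
    · rw [hν _ MeasurableSet.univ, Measure.map_apply hXT MeasurableSet.univ]
      simp
  rw [hrealint B hB, ← hν B hB, ← key, Measure.map_apply hXT hB, integral_indicator (hXT hB)]
  simp [measureReal_def]

variable [StandardBorelSpace 𝒳] [Nonempty 𝒳]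

/-- The conditional law of `X t` given all other observations. -/
def directingKernel (P : Measure Ω) [IsProbabilityMeasure P] {X : 𝒯 → Ω → 𝒳}
    (hX : ∀ t, Measurable (X t)) (t : 𝒯) : Kernel Ω 𝒳 :=
  (condDistrib (X t) (rest X {t}) P).comap (rest X {t}) (measurable_rest hX {t})

instance (hX : ∀ t, Measurable (X t)) (t : 𝒯) : IsMarkovKernel (directingKernel P hX t) := by
  unfold directingKernel
  infer_instance

theorem measurable_directingKernel_real (hX : ∀ t, Measurable (X t)) (t : 𝒯) {A : Set 𝒳}
    (hA : MeasurableSet A) :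
    Measurable[restSigma X {t}] fun ω => (directingKernel P hX t ω).real A :=
  ENNReal.measurable_toReal.comp (measurable_condDistrib hA)

theorem integral_hit_mul_eq_directingKernel (hX : ∀ t, Measurable (X t)) (t : 𝒯) {A : Set 𝒳}
    (hA : MeasurableSet A) {g : Ω → ℝ} (hg : AEStronglyMeasurable[restSigma X {t}] g P)
    (hg1 : ∀ᵐ ω ∂P, |g ω| ≤ 1) :
    ∫ ω, hit X A t ω * g ω ∂P = ∫ ω, (directingKernel P hX t ω).real A * g ω ∂P := by
  rw [← integral_condExp_mul_of_bound (restSigma_le hX {t}) (integrable_hit hX hA t) hg hg1]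
  refine integral_congr_ae ?_
  filter_upwards [condDistrib_ae_eq_condExp (μ := P) (measurable_rest hX {t}) (hX t) hA] with ω hω
  rw [show hit X A t = (X t ⁻¹' A).indicator fun _ => 1 from rfl, ← hω]
  rfl

end LocalExch

end

/-! ### Existence of the mixing process -/

noncomputable section

namespace LocalExch

variable {𝒯 Ω 𝒳 : Type*} [MeasurableSpace Ω] [MeasurableSpace 𝒳]
  {P : Measure Ω} {d : 𝒯 → 𝒯 → ℝ} {X : 𝒯 → Ω → 𝒳}

theorem integral_hit_mul_indicator (hX : ∀ t, Measurable (X t)) {A : Set 𝒳} (hA : MeasurableSet A)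
    (t : 𝒯) {B : Set Ω} (hB : MeasurableSet B) :
    ∫ ω, hit X A t ω * B.indicator (fun _ => 1) ω ∂P = P.real (X t ⁻¹' A ∩ B) := by
  have : ∀ ω, hit X A t ω * B.indicator (fun _ => 1) ω
      = (X t ⁻¹' A ∩ B).indicator (fun _ => (1 : ℝ)) ω := fun ω => by
    by_cases h1 : ω ∈ X t ⁻¹' A <;> by_cases h2 : ω ∈ B <;> simp [hit, h1, h2]
  simp_rw [this]
  rw [integral_indicator_const _ ((hX t hA).inter hB), smul_eq_mul, mul_one]

variable [IsProbabilityMeasure P]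

/-- Along a sequence of covariates converging to `t`, the observations converge to `X t` in law,
jointly with every event determined by the other observations. -/
theorem LocallyExchangeable.tendsto_real_inter (hexch : LocallyExchangeable P d X)
    (hd : IsPremetric d) (hX : ∀ t, Measurable (X t)) {A : Set 𝒳} (hA : MeasurableSet A) {t : 𝒯}
    {u : ℕ → 𝒯} (hu : Function.Injective u) (hut : Tendsto (fun n => d (u n) t) atTop (𝓝 0))
    {B : Set Ω} (hB : MeasurableSet[restSigma X {t}] B) :
    Tendsto (fun n => P.real (X (u n) ⁻¹' A ∩ B)) atTop (𝓝 (P.real (X t ⁻¹' A ∩ B))) := by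
  classical
  obtain ⟨D, hD, rfl⟩ := hB
  have hY := measurable_rest hX {t}
  have := Measure.isProbabilityMeasure_map (μ := P) hY.aemeasurable
  have hdense := Measure.MeasureDense.of_generateFrom_isSetAlgebra_finite
    (μ := P.map (rest X {t}))
    (isSetAlgebra_measurableCylinders (α := fun _ : {r // r ∉ ({t} : Set 𝒯)} => 𝒳))
    generateFrom_measurableCylinders.symm
  rw [Metric.tendsto_atTop]
  intro ε hε
  obtain ⟨E, hE, hDE⟩ := hdense.approx D hD (measure_ne_top _ _) (ε / 4) (by positivity)
  have hEm := MeasurableSet.of_mem_measurableCylinders hE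
  obtain ⟨J, S, hS, rfl⟩ := (mem_measurableCylinders _).1 hE
  set E : Set ({r // r ∉ ({t} : Set 𝒯)} → 𝒳) := cylinder J S
  have hlt : P.real (symmDiff (rest X {t} ⁻¹' D) (rest X {t} ⁻¹' E)) < ε / 4 := by
    have h1 := ENNReal.toReal_lt_of_lt_ofReal hDE
    rwa [← measureReal_def, map_measureReal_apply hY (hD.symmDiff hEm), Set.preimage_symmDiff] at h1
  have hclose : ∀ s, |P.real (X s ⁻¹' A ∩ rest X {t} ⁻¹' D) - P.real (X s ⁻¹' A ∩ rest X {t} ⁻¹' E)|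
      < ε / 4 := fun s => by
    refine (abs_measureReal_sub_le_measureReal_symmDiff
      ((hX s hA).inter (hY hD)).nullMeasurableSet
      ((hX s hA).inter (hY hEm)).nullMeasurableSet).trans_lt (lt_of_le_of_lt ?_ hlt)
    rw [← Set.inter_symmDiff_distrib_left]
    exact measureReal_mono Set.inter_subset_right
  -- The approximating cylinder reads only the finitely many covariates J, which the injective u
  -- eventually leaves. From then on, moving u n to t does not touch the cylinder.
  have hJ : ∀ᶠ n in atTop, u n ∉ J.map (Function.Embedding.subtype _) := by
    have := (J.map (Function.Embedding.subtype _)).finite_toSet.preimage hu.injOn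
    rw [← Nat.cofinite_eq_atTop]
    exact this.eventually_cofinite_notMem
  have hdt : ∀ᶠ n in atTop, d (u n) t < ε / 4 :=
    (tendsto_order.1 hut).2 _ (by positivity)
  obtain ⟨N, hN⟩ := eventually_atTop.1 (hJ.and hdt)
  refine ⟨N, fun n hn => ?_⟩
  obtain ⟨hnJ, hnd⟩ := hN n hn
  have hEu : MeasurableSet[restSigma X {u n, t}] (rest X {t} ⁻¹' E) := by
    have h1 : Measurable[restSigma X {u n, t}] fun ω (j : J) => X j ω :=
      @measurable_pi_lambda _ _ _ (restSigma X {u n, t}) _ _ fun j =>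
        measurable_restSigma fun hj => by
          rcases hj with hj | hj
          · exact hnJ (hj ▸ Finset.mem_map_of_mem _ j.2)
          · exact j.1.2 hj
    exact h1 hS
  have h2 := hexch.abs_integral_hit_mul_sub_le hd hX hA (u n) t
    ((measurable_const (a := (1 : ℝ))).indicator hEu).stronglyMeasurable.aestronglyMeasurable
    (ae_of_all _ fun ω => by by_cases hω : ω ∈ rest X {t} ⁻¹' E <;> simp [hω])
  rw [integral_hit_mul_indicator hX hA _ (hY hEm), integral_hit_mul_indicator hX hA _ (hY hEm)]
    at h2
  rw [Real.dist_eq]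
  have h3 := hclose (u n)
  have h4 := hclose t
  rw [abs_lt] at h3 h4 ⊢
  rw [abs_le] at h2
  constructor <;> linarith [h2.1, h2.2, h3.1, h3.2, h4.1, h4.2]

/-- Layer-cake formula in Z: each superlevel set is an event to which
`LocallyExchangeable.tendsto_real_inter` applies, and dominated convergence integrates over the
levels. -/
theorem LocallyExchangeable.tendsto_integral_hit_mul (hexch : LocallyExchangeable P d X)
    (hd : IsPremetric d) (hX : ∀ t, Measurable (X t)) {A : Set 𝒳} (hA : MeasurableSet A) {t : 𝒯}
    {u : ℕ → 𝒯} (hu : Function.Injective u) (hut : Tendsto (fun n => d (u n) t) atTop (𝓝 0))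
    {Z : Ω → ℝ} (hZ : Measurable[restSigma X {t}] Z) (hZ0 : ∀ ω, 0 ≤ Z ω) (hZ1 : ∀ ω, Z ω ≤ 1) :
    Tendsto (fun n => ∫ ω, hit X A (u n) ω * Z ω ∂P) atTop (𝓝 (∫ ω, hit X A t ω * Z ω ∂P)) := by
  have hZm : Measurable Z := hZ.mono (restSigma_le hX _) le_rfl
  have key : ∀ s, ∫ ω, hit X A s ω * Z ω ∂P
      = ∫ c in Set.Ioc 0 1, P.real (X s ⁻¹' A ∩ {ω | c ≤ Z ω}) := by
    intro s
    have h1 : ∀ ω, hit X A s ω * Z ω = (X s ⁻¹' A).indicator Z ω := fun ω => by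
      by_cases hω : ω ∈ X s ⁻¹' A <;> simp [hit, hω]
    simp_rw [h1]
    rw [integral_indicator (hX s hA)]
    have hZi : Integrable Z (P.restrict (X s ⁻¹' A)) :=
      Integrable.of_bound hZm.aestronglyMeasurable 1 (ae_of_all _ fun ω => by
        rw [Real.norm_of_nonneg (hZ0 ω)]; exact hZ1 ω)
    rw [hZi.integral_eq_integral_Ioc_meas_le (ae_of_all _ hZ0) (ae_of_all _ hZ1)]
    refine integral_congr_ae (ae_of_all _ fun c => ?_)
    simp only
    rw [measureReal_restrict_apply (measurableSet_le measurable_const hZm), Set.inter_comm]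
  simp_rw [key]
  refine tendsto_integral_of_dominated_convergence (fun _ => 1) (fun n => ?_) (integrable_const _)
    (fun n => ae_of_all _ fun c => ?_) (ae_of_all _ fun c => ?_)
  · have hanti : Antitone fun c => P.real (X (u n) ⁻¹' A ∩ {ω | c ≤ Z ω}) := fun a b hab =>
      measureReal_mono fun ω hω => ⟨hω.1, hab.trans hω.2⟩
    exact hanti.measurable.aestronglyMeasurable
  · rw [Real.norm_of_nonneg measureReal_nonneg]
    exact measureReal_le_one
  · exact hexch.tendsto_real_inter hd hX hA hu hut (@measurableSet_le _ _ _ _ _ (restSigma X {t}) _ _ _ _ _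
      (@measurable_const _ _ _ (restSigma X {t}) _) hZ)

variable [StandardBorelSpace 𝒳] [Nonempty 𝒳]

/-- The conditional law of `X t` given all other observations is determined by the observations
outside any given finite set of covariates. -/
theorem LocallyExchangeable.aestronglyMeasurable_directingKernel
    (hexch : LocallyExchangeable P d X) (hd : IsPremetric d) (hsep : InfinitelySeparable d)
    (hX : ∀ t, Measurable (X t)) {R : Set 𝒯} (hR : R.Finite) (t : 𝒯) {A : Set 𝒳}
    (hA : MeasurableSet A) :
    AEStronglyMeasurable[restSigma X R] (fun ω => (directingKernel P hX t ω).real A) P := by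
  obtain ⟨u, hu, hne, hut⟩ := hsep.exists_injective_tendsto t
  set Z : Ω → ℝ := fun ω => (directingKernel P hX t ω).real A with hZdef
  have hZt : Measurable[restSigma X {t}] Z := measurable_directingKernel_real hX t hA
  have hZ : Measurable Z := hZt.mono (restSigma_le hX _) le_rfl
  have hZ0 : ∀ ω, 0 ≤ Z ω := fun ω => measureReal_nonneg
  have hZ1 : ∀ ω, Z ω ≤ 1 := fun ω => measureReal_le_one
  have hZabs : ∀ ω, |Z ω| ≤ 1 := fun ω => (abs_of_nonneg (hZ0 ω)).trans_le (hZ1 ω)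
  have hev : ∀ᶠ n in atTop, u n ∉ R := by
    rw [← Nat.cofinite_eq_atTop]
    exact (hR.preimage hu.injOn).eventually_cofinite_notMem
  refine aestronglyMeasurable_of_forall_integral_mul_le (restSigma_le hX R) hZ hZ0 hZ1
    (f := fun n => hit X A (u n)) (hev.mono fun n hn => measurable_hit (measurable_restSigma hn) hA)
    (fun _ _ => hit_nonneg _ _) (fun _ _ => hit_le_one _ _) fun ε hε => ?_
  -- With f_n the indicator at u_n: moving u_j to t puts E[f_j f_i] within d(u_j, t) of E[Z f_i],
  -- while E[f_j Z] tends to E[Z²]. Hence the four terms of E[(f_i - Z)(f_j - Z)] cancel in pairs up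
  -- to ε.
  have hlim := hexch.tendsto_integral_hit_mul hd hX hA hu hut hZt hZ0 hZ1
  have hc : ∫ ω, hit X A t ω * Z ω ∂P = ∫ ω, Z ω * Z ω ∂P :=
    integral_hit_mul_eq_directingKernel hX t hA hZt.stronglyMeasurable.aestronglyMeasurable
      (ae_of_all _ hZabs)
  rw [hc] at hlim
  set c := ∫ ω, Z ω * Z ω ∂P
  have h1 : ∀ᶠ n in atTop, c - ε / 2 < ∫ ω, hit X A (u n) ω * Z ω ∂P :=
    (tendsto_order.1 hlim).1 _ (by linarith)
  have h2 : ∀ᶠ n in atTop, d (u n) t < ε / 2 := (tendsto_order.1 hut).2 _ (by positivity)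
  obtain ⟨K, hK⟩ := eventually_atTop.1 (h1.and h2)
  refine ⟨K, fun i hi j hj hij => ?_⟩
  have hfm : ∀ n, Measurable (hit X A (u n)) := fun n => measurable_hit (hX _) hA
  have hfi : ∀ s, Integrable (hit X A s) P := integrable_hit hX hA
  have hfj : |∫ ω, hit X A (u j) ω * hit X A (u i) ω ∂P - ∫ ω, hit X A t ω * hit X A (u i) ω ∂P|
      ≤ d (u j) t := by
    refine hexch.abs_integral_hit_mul_sub_le hd hX hA (u j) t
      (measurable_hit (measurable_restSigma ?_) hA).stronglyMeasurable.aestronglyMeasurable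
      (ae_of_all _ fun ω => abs_hit_le_one _ _)
    rintro (h | h)
    · exact hij (hu h)
    · exact hne i h
  have hft : ∫ ω, hit X A t ω * hit X A (u i) ω ∂P = ∫ ω, Z ω * hit X A (u i) ω ∂P :=
    integral_hit_mul_eq_directingKernel hX t hA
      (measurable_hit (measurable_restSigma (t := u i) fun h => hne i h)
        hA).stronglyMeasurable.aestronglyMeasurable
      (ae_of_all _ fun ω => abs_hit_le_one _ _)
  have hexp : ∫ ω, (hit X A (u i) ω - Z ω) * (hit X A (u j) ω - Z ω) ∂P
      = ∫ ω, hit X A (u j) ω * hit X A (u i) ω ∂P - ∫ ω, Z ω * hit X A (u i) ω ∂P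
        - ∫ ω, hit X A (u j) ω * Z ω ∂P + c := by
    have i1 : Integrable (fun ω => hit X A (u j) ω * hit X A (u i) ω) P :=
      (hfi _).bdd_mul (hfm j).aestronglyMeasurable (ae_of_all _ fun ω => abs_hit_le_one _ _)
    have i2 : Integrable (fun ω => Z ω * hit X A (u i) ω) P :=
      (hfi _).bdd_mul hZ.aestronglyMeasurable (ae_of_all _ hZabs)
    have i3 : Integrable (fun ω => hit X A (u j) ω * Z ω) P :=
      (hfi _).mul_bdd hZ.aestronglyMeasurable (ae_of_all _ hZabs)
    have i4 : Integrable (fun ω => Z ω * Z ω) P :=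
      Integrable.of_bound (hZ.mul hZ).aestronglyMeasurable 1 (ae_of_all _ fun ω => by
        rw [norm_mul]; exact mul_le_one₀ (hZabs ω) (norm_nonneg _) (hZabs ω))
    have i12 : Integrable (fun ω => hit X A (u j) ω * hit X A (u i) ω - Z ω * hit X A (u i) ω) P :=
      i1.sub i2
    have i123 : Integrable (fun ω => hit X A (u j) ω * hit X A (u i) ω - Z ω * hit X A (u i) ω
        - hit X A (u j) ω * Z ω) P := i12.sub i3
    rw [← integral_sub i1 i2, ← integral_sub i12 i3, ← integral_add i123 i4]
    refine integral_congr_ae (ae_of_all _ fun ω => ?_)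
    ring
  rw [hexp]
  have h3 := (abs_le.1 hfj).2
  have h4 := (hK j hj).1
  have h5 := (hK j hj).2
  rw [hft] at h3
  linarith

theorem LocallyExchangeable.isMixingProcess_directingKernel
    (hexch : LocallyExchangeable P d X) (hd : IsPremetric d) (hsep : InfinitelySeparable d)
    (hX : ∀ t, Measurable (X t)) : IsMixingProcess P d X (directingKernel P hX) where
  markov t := inferInstance
  condLaw T B hB := by
    refine condExp_eq_pi_of_integral_prod_hit_mul hX (fun t => inferInstance)
      (fun A hA T g hg hg1 => ?_) T hB
    exact integral_prod_hit_mul (fun t => inferInstance)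
      (fun s t A hA => hexch.aestronglyMeasurable_directingKernel hd hsep hX
        (Set.finite_singleton s) t hA)
      (fun t A hA g hg hg1 => integral_hit_mul_eq_directingKernel hX t hA hg (ae_of_all _ hg1))
      hA T hg hg1
  smooth t t' A hA := by
    set Z : 𝒯 → Ω → ℝ := fun s ω => (directingKernel P hX s ω).real A with hZ
    have hZm : ∀ s, Measurable (Z s) := fun s =>
      (measurable_directingKernel_real hX s hA).mono (restSigma_le hX _) le_rfl
    have hZi : ∀ s, Integrable (Z s) P := fun s =>
      Integrable.of_bound (hZm s).aestronglyMeasurable 1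
        (ae_of_all _ fun ω => abs_kernel_real_le_one (fun _ => inferInstance) s A ω)
    have hZr : ∀ s, AEStronglyMeasurable[restSigma X {t, t'}] (Z s) P := fun s =>
      hexch.aestronglyMeasurable_directingKernel hd hsep hX (Set.toFinite _) s hA
    obtain ⟨sgn, hsgn, hsgn1, hsgnmul⟩ := exists_measurable_sign
    -- By the tail property this sign is a.s. a function of the observations off both t and t', so
    -- it is unaffected when t is moved to t'.
    let φ : Ω → ℝ := fun ω => sgn (Z t ω - Z t' ω)
    have hφ : AEStronglyMeasurable[restSigma X {t, t'}] φ P := by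
      obtain ⟨g, hg, hgZ⟩ := (hZr t).sub (hZr t')
      exact ⟨fun ω => sgn (g ω), (hsgn.comp hg.measurable).stronglyMeasurable,
        hgZ.mono fun ω hω => congrArg sgn hω⟩
    have hφ1 : ∀ᵐ ω ∂P, |φ ω| ≤ 1 := ae_of_all _ fun ω => hsgn1 _
    have hφi : ∀ s, Integrable (fun ω => Z s ω * φ ω) P := fun s =>
      (hZi s).mul_bdd (hφ.mono (restSigma_le hX _)) hφ1
    have heq : ∀ s ∈ ({t, t'} : Set 𝒯), ∫ ω, hit X A s ω * φ ω ∂P = ∫ ω, Z s ω * φ ω ∂P :=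
      fun s hs => integral_hit_mul_eq_directingKernel hX s hA
        (hφ.mono (restSigma_anti (Set.singleton_subset_iff.2 hs))) hφ1
    calc ∫ ω, |Z t ω - Z t' ω| ∂P = ∫ ω, (Z t ω * φ ω - Z t' ω * φ ω) ∂P := by
          refine integral_congr_ae (ae_of_all _ fun ω => ?_)
          simp only [hsgnmul (Z t ω - Z t' ω), φ]
          ring
      _ = ∫ ω, hit X A t ω * φ ω ∂P - ∫ ω, hit X A t' ω * φ ω ∂P := by
          rw [integral_sub (hφi t) (hφi t'), heq t (by simp), heq t' (by simp)]
      _ ≤ d t t' := (le_abs_self _).trans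
          (hexch.abs_integral_hit_mul_sub_le hd hX hA t t' hφ hφ1)

end LocalExch

end

/-! ### Binned empirical measures, the tail property of mixing processes, and swaps within bins -/

noncomputable section

namespace LocalExch

section Empirical

variable {𝒳 : Type*} [MeasurableSpace 𝒳] {N : ℕ} {b : Fin N → ℕ}

theorem binnedEmpirical_apply (x : Fin N → 𝒳) (k : ℕ) {A : Set 𝒳} (hA : MeasurableSet A) :
    binnedEmpirical b x k A = ∑ i with b i = k, A.indicator 1 (x i) := by
  simp [binnedEmpirical, Measure.dirac_apply' _ hA]

theorem measurable_binnedEmpirical : Measurable (binnedEmpirical (𝒳 := 𝒳) b) := by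
  refine measurable_pi_lambda _ fun k => Measure.measurable_of_measurable_coe _ fun A hA => ?_
  simp only [binnedEmpirical_apply _ _ hA]
  exact Finset.measurable_sum _ fun i _ =>
    (measurable_one.indicator hA).comp (measurable_pi_apply i)

theorem binnedEmpirical_comp_perm {σ : Equiv.Perm (Fin N)} (hσ : ∀ i, b (σ i) = b i)
    (x : Fin N → 𝒳) : (binnedEmpirical b fun i => x (σ i)) = binnedEmpirical b x := by
  funext k
  refine Finset.sum_equiv σ (fun i => ?_) fun i _ => rfl
  simp [hσ]

theorem exists_perm_of_card_fiber_eq {β : Type*} {f g : Fin N → β}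
    (h : ∀ c, Nat.card {i // f i = c} = Nat.card {i // g i = c}) :
    ∃ σ : Equiv.Perm (Fin N), ∀ i, g (σ i) = f i := by
  classical
  have e : ∀ c, {i // f i = c} ≃ {i // g i = c} := fun c =>
    Fintype.equivOfCardEq (by simpa only [Nat.card_eq_fintype_card] using h c)
  refine ⟨(Equiv.sigmaFiberEquiv f).symm.trans
    ((Equiv.sigmaCongrRight e).trans (Equiv.sigmaFiberEquiv g)), fun i => ?_⟩
  exact (e (f i) ⟨i, rfl⟩).2

/-- The mass of {z} in bin k counts the indices with bin-value pair (k, z). Equal masses mean equal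
fibre sizes for these pairs, and equal fibres can be matched by a permutation. -/
theorem exists_perm_of_binnedEmpirical_singleton_eq [MeasurableSingletonClass 𝒳]
    {x y : Fin N → 𝒳} (h : ∀ k z, binnedEmpirical b x k {z} = binnedEmpirical b y k {z}) :
    ∃ σ : Equiv.Perm (Fin N), (∀ i, b (σ i) = b i) ∧ ∀ i, y (σ i) = x i := by
  classical
  have key : ∀ (x : Fin N → 𝒳) k z, binnedEmpirical b x k {z}
      = (Nat.card {i // (b i, x i) = (k, z)} : ENNReal) := by
    intro x k z
    rw [binnedEmpirical_apply _ _ (measurableSet_singleton z), Nat.card_eq_fintype_card,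
      Fintype.card_subtype]
    simp only [Set.indicator_apply, Set.mem_singleton_iff, Pi.one_apply, Finset.sum_boole,
      Finset.filter_filter, Prod.mk.injEq]
  obtain ⟨σ, hσ⟩ := exists_perm_of_card_fiber_eq (f := fun i => (b i, x i))
    (g := fun i => (b i, y i)) fun ⟨k, z⟩ => by
      have := h k z
      rw [key, key] at this
      exact_mod_cast this
  exact ⟨σ, fun i => (Prod.mk.injEq _ _ _ _ ▸ hσ i).1, fun i => (Prod.mk.injEq _ _ _ _ ▸ hσ i).2⟩

variable [StandardBorelSpace 𝒳]

/-- A measurable function of the observations that is invariant under permutations within bins is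
a measurable function of the binned empirical measures. -/
theorem measurable_comap_binnedEmpirical {H : (Fin N → 𝒳) → ℝ} (hH : Measurable H)
    (hinv : ∀ σ : Equiv.Perm (Fin N), (∀ i, b (σ i) = b i) → ∀ x, H (fun i => x (σ i)) = H x) :
    Measurable[MeasurableSpace.comap (binnedEmpirical b) inferInstance] H := by
  classical
  let e := embeddingReal 𝒳
  have he : MeasurableEmbedding e := measurableEmbedding_embeddingReal 𝒳
  -- Countably many distribution-function values encode the measures in a second countable space
  -- and, with the total masses fixed by b, still determine them.
  let Φ : (ℕ → Measure 𝒳) → ℕ → ℚ → ENNReal := fun ν k q => ν k (e ⁻¹' Set.Iic (q : ℝ))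
  have hΦ : Measurable Φ := measurable_pi_lambda _ fun k => measurable_pi_lambda _ fun q =>
    (Measure.measurable_coe (he.measurable measurableSet_Iic)).comp (measurable_pi_apply k)
  let Ψ : (Fin N → 𝒳) → ℕ → ℚ → ENNReal := Φ ∘ binnedEmpirical b
  have hΨ : Measurable Ψ := hΦ.comp measurable_binnedEmpirical
  have hfac : ∀ x y, Ψ x = Ψ y → H x = H y := by
    intro x y hxy
    have hsing : ∀ k z, binnedEmpirical b x k {z} = binnedEmpirical b y k {z} := by
      intro k z
      have hfin : ∀ x : Fin N → 𝒳, IsFiniteMeasure (binnedEmpirical b x k) := fun x => by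
        unfold binnedEmpirical
        infer_instance
      have hmap : (binnedEmpirical b x k).map e = (binnedEmpirical b y k).map e := by
        refine ext_of_generate_finite _ (Real.borel_eq_generateFrom_Iic_rat ▸ rfl)
          Real.isPiSystem_Iic_rat ?_ ?_
        · intro s hs
          obtain ⟨q, rfl⟩ := Set.mem_iUnion.1 hs
          rw [he.map_apply, he.map_apply]
          exact congrFun (congrFun hxy k) q
        · rw [he.map_apply, he.map_apply]
          simp [binnedEmpirical_apply]
      have h1 := congrArg (fun ν : Measure ℝ => ν {e z}) hmap
      simp only [he.map_apply] at h1
      rwa [show e ⁻¹' {e z} = {z} from by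
        ext w
        exact he.injective.eq_iff] at h1
    obtain ⟨σ, hσ, hyx⟩ := exists_perm_of_binnedEmpirical_singleton_eq hsing
    rw [← hinv σ hσ y]
    simp only [hyx]
  let K : (ℕ → ℚ → ENNReal) → ℝ := Function.extend Ψ H 0
  have hK : K ∘ Ψ = H := funext fun x =>
    Function.FactorsThrough.extend_apply (fun x y hxy => hfac x y hxy) 0 x
  -- Here the standard Borel structure enters. The range of Ψ is in general only analytic, but
  -- separation of analytic sets makes K measurable on it; the extension by 0 off the range plays no
  -- role.
  have hKr : Measurable (Set.domRestrict (Set.range Ψ) K) :=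
    hΨ.measurable_comp_iff_restrict.1 (hK ▸ hH)
  have hΨ' : Measurable[MeasurableSpace.comap (binnedEmpirical b) inferInstance] Ψ :=
    hΦ.comp (comap_measurable _)
  have : H = Set.domRestrict (Set.range Ψ) K ∘ fun x => ⟨Ψ x, x, rfl⟩ := hK.symm
  rw [this]
  exact hKr.comp (@Measurable.subtype_mk _ _ (MeasurableSpace.comap (binnedEmpirical b)
    inferInstance) _ _ _ hΨ' _)

end Empirical

variable {𝒯 Ω 𝒳 : Type*} [MeasurableSpace Ω] [MeasurableSpace 𝒳]
  {P : Measure Ω} {d : 𝒯 → 𝒯 → ℝ} {X : 𝒯 → Ω → 𝒳} {G : 𝒯 → Kernel Ω 𝒳}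

theorem IsMixingProcess.condExp_prod_hit (hG : IsMixingProcess P d X G) {A : Set 𝒳}
    (hA : MeasurableSet A) (T : Finset 𝒯) :
    P[fun ω => ∏ t ∈ T, hit X A t ω | processSigma G]
      =ᵐ[P] fun ω => ∏ t ∈ T, (G t ω).real A := by
  classical
  have := hG.markov
  have h := hG.condLaw T (Set.univ.pi fun _ => A) (MeasurableSet.univ_pi fun _ => hA)
  have h1 : (fun ω => ∏ t ∈ T, hit X A t ω)
      = ((fun ω (t : T) => X t ω) ⁻¹' Set.univ.pi fun _ => A).indicator fun _ => (1 : ℝ) := by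
    funext ω
    rw [← Finset.prod_coe_sort T fun t => hit X A t ω]
    by_cases hω : ∀ t : T, X t ω ∈ A
    · rw [Set.indicator_of_mem (show ω ∈ (fun ω (t : T) => X t ω) ⁻¹' Set.univ.pi fun _ => A from
        fun t _ => hω t)]
      exact Finset.prod_eq_one fun t _ => (hit_eq _ _).trans (Set.indicator_of_mem (hω t) _)
    · rw [Set.indicator_of_notMem (show ω ∉ (fun ω (t : T) => X t ω) ⁻¹' Set.univ.pi fun _ => A from
        fun hm => hω fun t => hm t trivial)]
      obtain ⟨t, ht⟩ := not_forall.1 hω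
      exact Finset.prod_eq_zero (Finset.mem_univ t)
        ((hit_eq _ _).trans (Set.indicator_of_notMem ht _))
  rw [h1]
  refine h.trans (ae_of_all _ fun ω => ?_)
  simp only [measureReal_def, Measure.pi_pi, ENNReal.toReal_prod]
  exact Finset.prod_coe_sort T fun t => (G t ω A).toReal

variable [IsProbabilityMeasure P]

/-- A mixing process is determined by the observations outside any given finite set of
covariates. -/
theorem IsMixingProcess.aestronglyMeasurable_real (hG : IsMixingProcess P d X G)
    (hsep : InfinitelySeparable d) (hX : ∀ t, Measurable (X t)) {R : Set 𝒯} (hR : R.Finite) (t : 𝒯)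
    {A : Set 𝒳} (hA : MeasurableSet A) :
    AEStronglyMeasurable[restSigma X R] (fun ω => (G t ω).real A) P := by
  classical
  have hmk := hG.markov
  obtain ⟨u, hu, -, hut⟩ := hsep.exists_injective_tendsto t
  set Z : 𝒯 → Ω → ℝ := fun s ω => (G s ω).real A with hZdef
  have hZσ : ∀ s, Measurable[processSigma G] (Z s) := fun s => measurable_processSigma_real s hA
  have hZ : ∀ s, Measurable (Z s) := fun s => (hZσ s).mono processSigma_le le_rfl
  have hZ0 : ∀ s ω, 0 ≤ Z s ω := fun s ω => measureReal_nonneg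
  have hZ1 : ∀ s ω, Z s ω ≤ 1 := fun s ω => measureReal_le_one
  have hZabs : ∀ s ω, |Z s ω| ≤ 1 := fun s ω => (abs_of_nonneg (hZ0 s ω)).trans_le (hZ1 s ω)
  have hev : ∀ᶠ n in atTop, u n ∉ R := by
    rw [← Nat.cofinite_eq_atTop]
    exact (hR.preimage hu.injOn).eventually_cofinite_notMem
  refine aestronglyMeasurable_of_forall_integral_mul_le (restSigma_le hX R) (hZ t) (hZ0 t) (hZ1 t)
    (f := fun n => hit X A (u n)) (hev.mono fun n hn => measurable_hit (measurable_restSigma hn) hA)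
    (fun _ _ => hit_nonneg _ _) (fun _ _ => hit_le_one _ _) fun ε hε => ?_
  obtain ⟨K, hK⟩ := eventually_atTop.1 ((tendsto_order.1 hut).2 _ hε)
  refine ⟨K, fun i hi j hj hij => ?_⟩
  have hfm : ∀ s, Measurable (hit X A s) := fun s => measurable_hit (hX _) hA
  have bdd : ∀ f g : Ω → ℝ, Measurable f → Measurable g → (∀ ω, |f ω| ≤ 1) → (∀ ω, |g ω| ≤ 1) →
      Integrable (fun ω => f ω * g ω) P := fun f g hf hg hf1 hg1 =>
    Integrable.of_bound (hf.mul hg).aestronglyMeasurable 1 (ae_of_all _ fun ω => by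
      rw [norm_mul]; exact mul_le_one₀ (hf1 ω) (norm_nonneg _) (hg1 ω))
  -- Used in both directions: expand with the indicators at u i and u j, replace them by their
  -- conditional means given G (independently, as u i ≠ u j), and recombine. The result is at most
  -- E|Z (u i) - Z t| ≤ d (u i) t.
  have hexp : ∀ f g : Ω → ℝ, Measurable f → Measurable g → (∀ ω, |f ω| ≤ 1) → (∀ ω, |g ω| ≤ 1) →
      ∫ ω, (f ω - Z t ω) * (g ω - Z t ω) ∂P = ∫ ω, f ω * g ω ∂P - ∫ ω, f ω * Z t ω ∂P
        - ∫ ω, g ω * Z t ω ∂P + ∫ ω, Z t ω * Z t ω ∂P := by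
    intro f g hf hg hf1 hg1
    have i1 := bdd f g hf hg hf1 hg1
    have i2 := bdd f (Z t) hf (hZ t) hf1 (hZabs t)
    have i3 := bdd g (Z t) hg (hZ t) hg1 (hZabs t)
    have i4 := bdd (Z t) (Z t) (hZ t) (hZ t) (hZabs t) (hZabs t)
    have i12 : Integrable (fun ω => f ω * g ω - f ω * Z t ω) P := i1.sub i2
    have i123 : Integrable (fun ω => f ω * g ω - f ω * Z t ω - g ω * Z t ω) P := i12.sub i3
    rw [← integral_sub i1 i2, ← integral_sub i12 i3, ← integral_add i123 i4]
    refine integral_congr_ae (ae_of_all _ fun ω => ?_)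
    ring
  have hone : ∀ s, ∫ ω, hit X A s ω * Z t ω ∂P = ∫ ω, Z s ω * Z t ω ∂P := by
    intro s
    rw [← integral_condExp_mul_of_bound processSigma_le (integrable_hit hX hA s)
      (hZσ t).stronglyMeasurable.aestronglyMeasurable (ae_of_all _ (hZabs t))]
    refine integral_congr_ae ?_
    have h1 := hG.condExp_prod_hit hA {s}
    simp only [Finset.prod_singleton] at h1
    filter_upwards [h1] with ω hω
    rw [show hit X A s = fun ω => hit X A s ω from rfl, hω]
  have htwo : ∫ ω, hit X A (u i) ω * hit X A (u j) ω ∂P = ∫ ω, Z (u i) ω * Z (u j) ω ∂P := by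
    rw [← integral_condExp (processSigma_le (G := G))]
    have h1 := hG.condExp_prod_hit hA {u i, u j}
    simp only [Finset.prod_pair fun h => hij (hu h)] at h1
    exact integral_congr_ae h1
  rw [hexp _ _ (hfm _) (hfm _) (abs_hit_le_one _) (abs_hit_le_one _), hone, hone, htwo,
    ← hexp _ _ (hZ _) (hZ _) (hZabs _) (hZabs _)]
  have hdiff : ∀ s ω, |Z s ω - Z t ω| ≤ 1 := fun s ω => by
    rw [abs_le]
    constructor <;> linarith [hZ0 s ω, hZ1 s ω, hZ0 t ω, hZ1 t ω]
  have hi1 : Integrable (fun ω => |Z (u i) ω - Z t ω|) P :=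
    Integrable.of_bound ((hZ _).sub (hZ _)).abs.aestronglyMeasurable 1 (ae_of_all _ fun ω => by
      rw [Real.norm_eq_abs, abs_abs]
      exact hdiff _ ω)
  have hi2 : Integrable (fun ω => (Z (u i) ω - Z t ω) * (Z (u j) ω - Z t ω)) P :=
    bdd _ _ ((hZ _).sub (hZ _)) ((hZ _).sub (hZ _)) (hdiff _) (hdiff _)
  refine (integral_mono hi2 hi1 fun ω => ?_).trans ((hG.smooth (u i) t A hA).trans (hK i hi).le)
  refine (le_abs_self _).trans ?_
  rw [abs_mul]
  exact mul_le_of_le_one_right (abs_nonneg _) (hdiff _ ω)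

/-- Permuting the covariates within bins changes the expectation of a bounded function of the
observations, weighted by a function of the binned empirical measures and of the mixing process,
by little. -/
theorem IsMixingProcess.abs_integral_sub_perm_le (hG : IsMixingProcess P d X G)
    (hexch : LocallyExchangeable P d X) (hd : IsPremetric d) (hsep : InfinitelySeparable d)
    (hX : ∀ t, Measurable (X t)) {N : ℕ} {b : Fin N → ℕ} {s : Fin N → 𝒯}
    (hs : Function.Injective s) {σ : Equiv.Perm (Fin N)} (hσ : ∀ i, b (σ i) = b i)
    {h : (Fin N → 𝒳) → ℝ} (hh : Measurable h) {C : ℝ} (hC : ∀ x, |h x| ≤ C) {g : Ω → ℝ}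
    (hg : Measurable[MeasurableSpace.comap (fun ω => binnedEmpirical b fun i => X (s i) ω)
      inferInstance ⊔ processSigma G] g) (hg1 : ∀ ω, |g ω| ≤ 1) :
    |∫ ω, h (fun i => X (s i) ω) * g ω ∂P - ∫ ω, h (fun i => X (s (σ i)) ω) * g ω ∂P|
      ≤ 2 * C * ∑ i, d (s i) (s (σ i)) := by
  have hC0 : 0 ≤ C := by
    obtain ⟨ω⟩ := nonempty_of_isProbabilityMeasure P
    exact (abs_nonneg _).trans (hC fun i => X (s i) ω)
  set R : Set 𝒯 := Set.range s with hR
  let Y : Ω → (ℕ → Measure 𝒳) × ({r // r ∉ R} → 𝒳) := fun ω =>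
    (binnedEmpirical b fun i => X (s i) ω, rest X R ω)
  have hYfst : MeasurableSpace.comap (fun ω => binnedEmpirical b fun i => X (s i) ω) inferInstance
      ≤ MeasurableSpace.comap Y inferInstance :=
    Measurable.comap_le (measurable_fst.comp (comap_measurable Y))
  have hYsnd : restSigma X R ≤ MeasurableSpace.comap Y inferInstance :=
    Measurable.comap_le (measurable_snd.comp (comap_measurable Y))
  -- The tail property trades G for the observations outside T, so the weight becomes a function of
  -- Ĝ and of those observations.
  have hgY : AEStronglyMeasurable[MeasurableSpace.comap Y inferInstance] g P :=
    aestronglyMeasurable_of_le_eventuallyMeasurableSpace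
      (sup_le (hYfst.trans le_eventuallyMeasurableSpace)
        (processSigma_le_eventuallyMeasurableSpace hG.markov fun t A hA =>
          (hG.aestronglyMeasurable_real hsep hX (Set.finite_range s) t hA).mono hYsnd)) hg
  obtain ⟨ψ, hψ, hψ1, hgψ⟩ := exists_ae_eq_comp_of_bound hgY zero_le_one (ae_of_all _ hg1)
  let H : (Fin N → 𝒳) × ({r // r ∉ R} → 𝒳) → ℝ := fun x => h x.1 * ψ (binnedEmpirical b x.1, x.2)
  have hH : Measurable H := (hh.comp measurable_fst).mul
    (hψ.comp ((measurable_binnedEmpirical.comp measurable_fst).prodMk measurable_snd))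
  have hHb : ∀ x, |H x| ≤ C := fun x => by
    rw [abs_mul]
    exact (mul_le_mul (hC _) (hψ1 _) (abs_nonneg _) hC0).trans_eq (mul_one C)
  have key := hexch.abs_integral_sub_le hd hX hs (hs.comp σ.injective) (R := R)
    (fun i => Set.mem_range_self i) (fun i => Set.mem_range_self _) hH (a := -C) (b := C)
    (by linarith) (fun x => (abs_le.1 (hHb x)).1) (fun x => (abs_le.1 (hHb x)).2)
  have h1 : ∫ ω, h (fun i => X (s i) ω) * g ω ∂P
      = ∫ ω, H (fun i => X (s i) ω, rest X R ω) ∂P :=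
    integral_congr_ae (hgψ.mono fun ω hω => by simp only [hω, H, Y])
  -- The same H serves after the permutation, because Ĝ is unchanged by σ.
  have h2 : ∫ ω, h (fun i => X (s (σ i)) ω) * g ω ∂P
      = ∫ ω, H (fun i => X ((s ∘ σ) i) ω, rest X R ω) ∂P :=
    integral_congr_ae (hgψ.mono fun ω hω => by
      simp only [hω, H, Y, Function.comp_apply,
        binnedEmpirical_comp_perm hσ fun i => X (s i) ω])
  rw [h1, h2]
  refine key.trans (le_of_eq ?_)
  simp only [Function.comp_apply]
  ring

end LocalExch

end

/-! ### Averaging over bin permutations and the final bound -/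

noncomputable section

namespace LocalExch

/-- If `k` has conditional expectation close to zero given `m`, then `k + c`, with `c` measurable
with respect to a smaller σ-algebra, has similar conditional expectations given both. -/
theorem integral_abs_condExp_sub_condExp_le {Ω : Type*} {m' m : MeasurableSpace Ω}
    [m0 : MeasurableSpace Ω] {P : Measure Ω} [IsProbabilityMeasure P] (hm' : m' ≤ m) (hm : m ≤ m0)
    {f c : Ω → ℝ} (hf : Integrable f P) (hc : StronglyMeasurable[m'] c) (hci : Integrable c P) :
    ∫ ω, |(P[f | m]) ω - (P[f | m']) ω| ∂P
      ≤ 2 * ∫ ω, |(P[fun ω => f ω - c ω | m]) ω| ∂P := by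
  set W := P[fun ω => f ω - c ω | m] with hW
  have hkey : ∀ n : MeasurableSpace Ω, n ≤ m0 → StronglyMeasurable[n] c →
      P[f | n] =ᵐ[P] fun ω => (P[fun ω => f ω - c ω | n]) ω + c ω := by
    intro n hn hcn
    filter_upwards [condExp_sub hf hci n] with ω hω
    rw [show (fun ω => f ω - c ω) = f - c from rfl, hω, Pi.sub_apply,
      condExp_of_stronglyMeasurable hn hcn hci, sub_add_cancel]
  -- Once c has cancelled, the difference is W - E[W | m']; the L¹ contraction E|E[W | m']| ≤ E|W|
  -- gives the factor 2.
  have htower : P[W | m'] =ᵐ[P] P[fun ω => f ω - c ω | m'] := condExp_condExp_of_le hm' hm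
  have hWi : Integrable W P := integrable_condExp
  calc ∫ ω, |(P[f | m]) ω - (P[f | m']) ω| ∂P = ∫ ω, |W ω - (P[W | m']) ω| ∂P := by
        refine integral_congr_ae ?_
        filter_upwards [hkey m hm (hc.mono hm'), hkey m' (hm'.trans hm) hc, htower] with ω h1 h2 h3
        rw [h1, h2, h3, add_sub_add_right_eq_sub]
    _ ≤ ∫ ω, (|W ω| + |(P[W | m']) ω|) ∂P :=
        integral_mono (hWi.sub integrable_condExp).abs (hWi.abs.add integrable_condExp.abs)
          fun ω => abs_sub _ _
    _ = ∫ ω, |W ω| ∂P + ∫ ω, |(P[W | m']) ω| ∂P := integral_add hWi.abs integrable_condExp.abs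
    _ ≤ 2 * ∫ ω, |W ω| ∂P := by
        have := integral_abs_condExp_le (μ := P) (m := m') W
        linarith

/-- The `L¹` norm of a conditional expectation is attained by integrating against a measurable
sign. -/
theorem exists_integral_abs_condExp_eq {Ω : Type*} {m : MeasurableSpace Ω}
    [m0 : MeasurableSpace Ω] {P : Measure Ω} [IsProbabilityMeasure P] (hm : m ≤ m0)
    {k : Ω → ℝ} (hk : Integrable k P) :
    ∃ g : Ω → ℝ, Measurable[m] g ∧ (∀ ω, |g ω| ≤ 1) ∧
      ∫ ω, |(P[k | m]) ω| ∂P = ∫ ω, k ω * g ω ∂P := by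
  obtain ⟨sgn, hsgn, hsgn1, hsgnmul⟩ := exists_measurable_sign
  have hg : Measurable[m] fun ω => sgn ((P[k | m]) ω) :=
    hsgn.comp stronglyMeasurable_condExp.measurable
  refine ⟨fun ω => sgn ((P[k | m]) ω), hg, fun ω => hsgn1 _, ?_⟩
  rw [← integral_condExp_mul_of_bound hm hk hg.stronglyMeasurable.aestronglyMeasurable
    (ae_of_all _ fun ω => hsgn1 _)]
  simp only [hsgnmul]

/-- The average of a function of the observations over all permutations within bins. -/
def binAverage {𝒳 : Type*} {N : ℕ} (b : Fin N → ℕ) (h : (Fin N → 𝒳) → ℝ) (x : Fin N → 𝒳) : ℝ :=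
  ((binPerms b).card : ℝ)⁻¹ * ∑ σ ∈ binPerms b, h fun i => x (σ i)

section BinAverage

variable {𝒳 : Type*} {N : ℕ} {b : Fin N → ℕ} {h : (Fin N → 𝒳) → ℝ}

theorem mem_binPerms {σ : Equiv.Perm (Fin N)} : σ ∈ binPerms b ↔ ∀ i, b (σ i) = b i := by
  simp [binPerms]

theorem card_binPerms_pos : (0 : ℝ) < (binPerms b).card :=
  Nat.cast_pos.2 (Finset.card_pos.2 ⟨1, mem_binPerms.2 fun _ => rfl⟩)

theorem measurable_binAverage [MeasurableSpace 𝒳] (hh : Measurable h) : Measurable (binAverage b h) :=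
  Measurable.const_mul (Finset.measurable_sum _ fun σ _ =>
    hh.comp (measurable_pi_lambda _ fun i => measurable_pi_apply (σ i))) _

theorem binAverage_comp_perm {σ : Equiv.Perm (Fin N)} (hσ : ∀ i, b (σ i) = b i) (x : Fin N → 𝒳) :
    (binAverage b h fun i => x (σ i)) = binAverage b h x := by
  unfold binAverage
  congr 1
  refine Finset.sum_equiv (Equiv.mulLeft σ) (fun ρ => ?_) fun ρ _ => rfl
  simp [mem_binPerms, hσ]

theorem sub_binAverage (x : Fin N → 𝒳) : h x - binAverage b h x
    = ((binPerms b).card : ℝ)⁻¹ * ∑ σ ∈ binPerms b, (h x - h fun i => x (σ i)) := by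
  have := (card_binPerms_pos (b := b)).ne'
  rw [Finset.sum_sub_distrib, Finset.sum_const, nsmul_eq_mul, mul_sub, binAverage,
    inv_mul_cancel_left₀ this]

theorem abs_binAverage_le {C : ℝ} (hC : ∀ x, |h x| ≤ C) (x : Fin N → 𝒳) :
    |binAverage b h x| ≤ C := by
  have hpos := card_binPerms_pos (b := b)
  rw [binAverage, abs_mul, abs_of_pos (inv_pos.2 hpos), inv_mul_le_iff₀ hpos, ← nsmul_eq_mul]
  exact (Finset.abs_sum_le_sum_abs _ _).trans (Finset.sum_le_card_nsmul _ _ _ fun σ _ => hC _)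

end BinAverage

/-- Sections of functions of the binned empirical measures and of the mixing process. -/
theorem measurable_section_empiricalMixingSigma {𝒯 Ω 𝒳 Ξ : Type*} [MeasurableSpace Ω]
    [MeasurableSpace 𝒳] {X : 𝒯 → Ω → 𝒳} {G : 𝒯 → Kernel Ω 𝒳} {N : ℕ} {b : Fin N → ℕ} {τ : Fin N → Ξ → 𝒯}
    {g : Ω × Ξ → ℝ} (hg : Measurable[empiricalMixingSigma X G b τ] g) (ξ : Ξ) :
    Measurable[MeasurableSpace.comap (fun ω => binnedEmpirical b fun i => X (τ i ξ) ω)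
      inferInstance ⊔ processSigma G] fun ω => g (ω, ξ) := by
  refine hg.comp (measurable_iff_comap_le.2 ?_)
  rw [MeasurableSpace.comap_sup, MeasurableSpace.comap_comp, MeasurableSpace.comap_comp]
  exact sup_le_sup le_rfl MeasurableSpace.comap_id.le

variable {𝒯 Ω 𝒳 Ξ : Type*} [MeasurableSpace Ω] [MeasurableSpace 𝒳] [MeasurableSpace Ξ]
  {P : Measure Ω} [IsProbabilityMeasure P] {Q : Measure Ξ} [IsProbabilityMeasure Q]
  {d : 𝒯 → 𝒯 → ℝ} {X : 𝒯 → Ω → 𝒳} {G : 𝒯 → Kernel Ω 𝒳}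

theorem exists_isMixingProcess [StandardBorelSpace 𝒳] (hd : IsPremetric d)
    (hsep : InfinitelySeparable d) (hX : ∀ t, Measurable (X t))
    (hexch : LocallyExchangeable P d X) : ∃ G : 𝒯 → Kernel Ω 𝒳, IsMixingProcess P d X G := by
  -- The conditional law needs a point of 𝒳, which any value of X supplies. Without covariates 𝒳 may
  -- be empty, but then only the empty product has to be checked.
  rcases isEmpty_or_nonempty 𝒯 with h𝒯 | ⟨⟨t⟩⟩
  · refine ⟨fun t => h𝒯.elim t, fun t => h𝒯.elim t, fun T B hB => ?_, fun t => h𝒯.elim t⟩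
    refine condExp_eq_pi_of_integral_prod_hit_mul hX (fun t => h𝒯.elim t)
      (fun A _ T g _ _ => ?_) T hB
    rw [Finset.eq_empty_of_isEmpty T]
    rfl
  · obtain ⟨ω⟩ := nonempty_of_isProbabilityMeasure P
    have : Nonempty 𝒳 := ⟨X t ω⟩
    exact ⟨_, hexch.isMixingProcess_directingKernel hd hsep hX⟩

theorem empiricalSigma_le {N : ℕ} {b : Fin N → ℕ} {τ : Fin N → Ξ → 𝒯}
    (hobs : Measurable (obs X τ)) : empiricalSigma X b τ ≤ Prod.instMeasurableSpace :=
  (measurable_binnedEmpirical.comp hobs).comap_le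

theorem empiricalMixingSigma_le {N : ℕ} {b : Fin N → ℕ} {τ : Fin N → Ξ → 𝒯}
    (hobs : Measurable (obs X τ)) : empiricalMixingSigma X G b τ ≤ Prod.instMeasurableSpace :=
  sup_le (empiricalSigma_le hobs)
    ((MeasurableSpace.comap_mono processSigma_le).trans measurable_fst.comap_le)

/-- By Fubini the positions may be frozen at ξ; a test function of (Ĝ, G) then becomes one of Ĝ at
these positions and of G. The swap bound applies for each σ, and averaging over σ and ξ produces the
expected swap cost. -/
theorem IsMixingProcess.integral_sub_binAverage_mul_le [StandardBorelSpace 𝒳]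
    (hG : IsMixingProcess P d X G) (hexch : LocallyExchangeable P d X) (hd : IsPremetric d)
    (hsep : InfinitelySeparable d) (hX : ∀ t, Measurable (X t)) {N : ℕ} {b : Fin N → ℕ}
    {τ : Fin N → Ξ → 𝒯} (hτinj : ∀ᵐ ξ ∂Q, Function.Injective fun i => τ i ξ)
    (hobs : Measurable (obs X τ)) (hdist : ∀ i j, Measurable fun ξ => d (τ i ξ) (τ j ξ))
    {h : (Fin N → 𝒳) → ℝ} (hh : Measurable h) {C : ℝ} (hC : ∀ x, |h x| ≤ C) {g : Ω × Ξ → ℝ}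
    (hg : Measurable[empiricalMixingSigma X G b τ] g) (hg1 : ∀ p, |g p| ≤ 1) :
    ∫ p, (h (obs X τ p) - binAverage b h (obs X τ p)) * g p ∂(P.prod Q)
      ≤ 2 * C * expectedSwapCost Q d b τ := by
  have hgm : Measurable g := hg.mono (empiricalMixingSigma_le hobs) le_rfl
  have hC0 : 0 ≤ C := by
    obtain ⟨p⟩ := nonempty_of_isProbabilityMeasure (P.prod Q)
    exact (abs_nonneg _).trans (hC (obs X τ p))
  have hint : Integrable (fun p => (h (obs X τ p) - binAverage b h (obs X τ p)) * g p)
      (P.prod Q) := by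
    refine Integrable.of_bound ((((hh.comp hobs).sub
      ((measurable_binAverage hh).comp hobs)).mul hgm).aestronglyMeasurable) (C + C)
      (ae_of_all _ fun p => ?_)
    rw [norm_mul]
    refine (mul_le_of_le_one_right (norm_nonneg _) (hg1 p)).trans ((norm_sub_le _ _).trans ?_)
    exact add_le_add (hC _) (abs_binAverage_le hC _)
  have hcost : Integrable (fun ξ => ((binPerms b).card : ℝ)⁻¹ *
      ∑ σ ∈ binPerms b, ∑ i, d (τ i ξ) (τ (σ i) ξ)) Q := by
    refine Integrable.const_mul (integrable_finsetSum _ fun σ _ => integrable_finsetSum _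
      fun i _ => Integrable.of_bound (hdist _ _).aestronglyMeasurable 1 (ae_of_all _ fun ξ => ?_)) _
    rw [Real.norm_of_nonneg (hd.nonneg _ _)]
    exact hd.le_one _ _
  rw [integral_prod_symm _ hint, expectedSwapCost, ← integral_const_mul]
  refine integral_mono_ae hint.integral_prod_right (hcost.const_mul _) ?_
  filter_upwards [hτinj] with ξ hξ
  have hgξ := measurable_section_empiricalMixingSigma hg ξ
  have hgξm : Measurable fun ω => g (ω, ξ) := hgm.comp measurable_prodMk_right
  have hterm : ∀ s : Fin N → 𝒯, Integrable (fun ω => h (fun i => X (s i) ω) * g (ω, ξ)) P :=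
    fun s => Integrable.of_bound ((hh.comp (measurable_pi_lambda _ fun i =>
      hX (s i))).mul hgξm).aestronglyMeasurable C (ae_of_all _ fun ω => by
        rw [norm_mul]
        exact (mul_le_of_le_one_right (norm_nonneg _) (hg1 _)).trans (hC _))
  calc ∫ ω, (h (obs X τ (ω, ξ)) - binAverage b h (obs X τ (ω, ξ))) * g (ω, ξ) ∂P
      = ((binPerms b).card : ℝ)⁻¹ * ∑ σ ∈ binPerms b,
          (∫ ω, h (fun i => X (τ i ξ) ω) * g (ω, ξ) ∂P
            - ∫ ω, h (fun i => X (τ (σ i) ξ) ω) * g (ω, ξ) ∂P) := by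
        have hsub : ∀ σ ∈ binPerms b, Integrable (fun ω => h (fun i => X (τ i ξ) ω) * g (ω, ξ)
            - h (fun i => X (τ (σ i) ξ) ω) * g (ω, ξ)) P := fun σ _ =>
          (hterm fun i => τ i ξ).sub (hterm fun i => τ (σ i) ξ)
        rw [Finset.sum_congr rfl fun σ _ => (integral_sub (hterm fun i => τ i ξ)
          (hterm fun i => τ (σ i) ξ)).symm, ← integral_finsetSum _ hsub, ← integral_const_mul]
        refine integral_congr_ae (ae_of_all _ fun ω => ?_)
        simp only [sub_binAverage, mul_assoc, Finset.sum_mul, sub_mul]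
        rfl
    _ ≤ ((binPerms b).card : ℝ)⁻¹ * ∑ σ ∈ binPerms b,
          2 * C * ∑ i, d (τ i ξ) (τ (σ i) ξ) := by
        refine mul_le_mul_of_nonneg_left (Finset.sum_le_sum fun σ hσ => ?_)
          (inv_nonneg.2 card_binPerms_pos.le)
        exact (le_abs_self _).trans (hG.abs_integral_sub_perm_le hexch hd hsep hX
          (s := fun i => τ i ξ) hξ (mem_binPerms.1 hσ) hh hC hgξ fun ω => hg1 _)
    _ = 2 * C * (((binPerms b).card : ℝ)⁻¹ *
          ∑ σ ∈ binPerms b, ∑ i, d (τ i ξ) (τ (σ i) ξ)) := by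
        rw [← Finset.mul_sum, mul_left_comm]

/-- The bin average is the σ(Ĝ)-measurable centring c, and the sign of E[h(X_T) - c | Ĝ, G] is the
test function. The constant is 2 from the centring times 2C from the swap. -/
theorem IsMixingProcess.integral_abs_condExp_sub_le [StandardBorelSpace 𝒳]
    (hG : IsMixingProcess P d X G) (hexch : LocallyExchangeable P d X) (hd : IsPremetric d)
    (hsep : InfinitelySeparable d) (hX : ∀ t, Measurable (X t)) {N : ℕ} {b : Fin N → ℕ}
    {τ : Fin N → Ξ → 𝒯} (hτinj : ∀ᵐ ξ ∂Q, Function.Injective fun i => τ i ξ)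
    (hobs : Measurable (obs X τ)) (hdist : ∀ i j, Measurable fun ξ => d (τ i ξ) (τ j ξ))
    {h : (Fin N → 𝒳) → ℝ} (hh : Measurable h) {C : ℝ} (hC : ∀ x, |h x| ≤ C) :
    ∫ p, |((P.prod Q)[fun q => h (obs X τ q) | empiricalMixingSigma X G b τ]) p
        - ((P.prod Q)[fun q => h (obs X τ q) | empiricalSigma X b τ]) p| ∂(P.prod Q)
      ≤ 4 * C * expectedSwapCost Q d b τ := by
  have hf : Integrable (fun p => h (obs X τ p)) (P.prod Q) :=
    Integrable.of_bound (hh.comp hobs).aestronglyMeasurable C (ae_of_all _ fun p => hC _)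
  have hc : Integrable (fun p => binAverage b h (obs X τ p)) (P.prod Q) :=
    Integrable.of_bound ((measurable_binAverage hh).comp hobs).aestronglyMeasurable C
      (ae_of_all _ fun p => abs_binAverage_le hC _)
  have hcm : Measurable[empiricalSigma X b τ] fun p => binAverage b h (obs X τ p) := by
    refine (measurable_comap_binnedEmpirical (b := b) (measurable_binAverage hh)
      fun σ hσ x => binAverage_comp_perm hσ x).comp (measurable_iff_comap_le.2 ?_)
    rw [MeasurableSpace.comap_comp]
    exact le_rfl
  obtain ⟨g, hg, hg1, hkg⟩ := exists_integral_abs_condExp_eq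
    (empiricalMixingSigma_le (G := G) (b := b) hobs) (hf.sub hc)
  have h1 := integral_abs_condExp_sub_condExp_le (m' := empiricalSigma X b τ)
    (m := empiricalMixingSigma X G b τ) le_sup_left (empiricalMixingSigma_le hobs) hf
    hcm.stronglyMeasurable hc
  have h2 := hG.integral_sub_binAverage_mul_le hexch hd hsep hX hτinj hobs hdist hh hC hg hg1
  refine h1.trans ?_
  calc _ = 2 * ∫ p, (h (obs X τ p) - binAverage b h (obs X τ p)) * g p ∂(P.prod Q) :=
        congrArg (2 * ·) hkg
    _ ≤ _ := by linarith

end LocalExch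

end

theorem mainTheorem4
    {𝒯 Ω 𝒳 Ξ : Type*} [MeasurableSpace Ω] [MeasurableSpace Ξ]
    [MeasurableSpace 𝒳] [StandardBorelSpace 𝒳]
    -- the process `X` on `(Ω, P)`, locally exchangeable over an infinitely separable space
    (P : Measure Ω) [IsProbabilityMeasure P]
    (d : 𝒯 → 𝒯 → ℝ) (hd : LocalExch.IsPremetric d)
    (hsep : LocalExch.InfinitelySeparable d)
    (X : 𝒯 → Ω → 𝒳) (hX : ∀ t, Measurable (X t))
    (hexch : LocalExch.LocallyExchangeable P d X)
    -- the partition of the covariate space into bins (all but finitely many may be empty)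
    (bins : ℕ → Set 𝒯) (hdisj : Pairwise (Function.onFun Disjoint bins))
    (hcover : ⋃ k, bins k = Set.univ)
    -- `N` distinct random covariates on `(Ξ, Q)`, the `i`-th one lying in the known bin `b i`
    (Q : Measure Ξ) [IsProbabilityMeasure Q]
    (N : ℕ) (b : Fin N → ℕ) (τ : Fin N → Ξ → 𝒯)
    (hτinj : ∀ᵐ ξ ∂Q, Function.Injective fun i => τ i ξ)
    (hτbin : ∀ᵐ ξ ∂Q, ∀ i, τ i ξ ∈ bins (b i))
    -- the observations and the distances between the covariates are random variables
    (hobs : Measurable (LocalExch.obs X τ))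
    (hdist : ∀ i j, Measurable fun ξ => d (τ i ξ) (τ j ξ)) :
    (∃ G : 𝒯 → Kernel Ω 𝒳, LocalExch.IsMixingProcess P d X G) ∧
    ∀ G : 𝒯 → Kernel Ω 𝒳, LocalExch.IsMixingProcess P d X G →
      ∀ h : (Fin N → 𝒳) → ℝ, Measurable h → (∃ C, ∀ x, |h x| ≤ C) →
        ∫ p, |((P.prod Q)[fun q => h (LocalExch.obs X τ q) |
                LocalExch.empiricalMixingSigma X G b τ]) p
            - ((P.prod Q)[fun q => h (LocalExch.obs X τ q) |
                LocalExch.empiricalSigma X b τ]) p| ∂(P.prod Q)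
          ≤ 4 * (⨆ x, |h x|) * LocalExch.expectedSwapCost Q d b τ := by
  refine ⟨LocalExch.exists_isMixingProcess hd hsep hX hexch, fun G hG h hh ⟨C, hC⟩ => ?_⟩
  refine hG.integral_abs_condExp_sub_le hexch hd hsep hX hτinj hobs hdist hh fun x => ?_
  exact le_ciSup (f := fun x => |h x|) ⟨C, by rintro _ ⟨y, rfl⟩; exact hC y⟩ x
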